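/- For uniformly bounded complex sequences $(a_j)_{j\ge1},(b_j)_{j\ge1},(c_j)_{j\ge1}$ let $J=J(\{a_j\},\{b_j\},\{c_j\})$ be the bounded operator on $\ell^2(\mathbb N)$ given by the semi-infinite tridiagonal matrix with diagonal $b_1,b_2,\dots$, lower diagonal $a_1,a_2,\dots$ and upper diagonal $c_1,c_2,\dots$, and let $J_0=J(\{1\},\{0\},\{1\})$. Let $\sigma_d(J)$ be the set of isolated points of the spectrum of $J$ that are eigenvalues of finite algebraic multiplicity, and let $\|\cdot\|_1$ be the trace norm. For $n\in\mathbb N$ and $0<\alpha<1$ put $J_{n,\alpha}=J_0+i\,n^{-\alpha}P_n$, where $P_n$ is the orthogonal projection onto the span of the first $n$ standard basis vectors. (1) For every $\alpha\in(0,1)$ there is a constant $C>0$ (depending only on $\alpha$) such that for all sufficiently large $n$ $$\frac1{\|J_{n,\alpha}-J_0\|_1}\sum_{\lambda\in\sigma_d(J_{n,\alpha})}\frac{\operatorname{dist}(\lambda,[-2,2])}{|\lambda^2-4|^{1/2}}\ \ge\ C\log n ,$$ where each point of $\sigma_d(J_{n,\alpha})$ is counted once. In particular, for every $\alpha\in(0,1)$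 $$\lim_{n\to\infty}\frac1{\|J_{n,\alpha}-J_0\|_1}\sum_{\lambda\in\sigma_d(J_{n,\alpha})}\frac{\operatorname{dist}(\lambda,[-2,2])}{|\lambda^2-4|^{1/2}}=+\infty .$$ (2) Consequently, the Lieb--Thirring inequality $$\sum_{\lambda\in\sigma_d(J)}\frac{\operatorname{dist}(\lambda,[-2,2])}{|\lambda^2-4|^{\frac{1-\varepsilon}2}}\ \le\ C(\varepsilon)\sum_{j=1}^\infty\bigl(|b_j|+|1-a_jc_j|\bigr)$$ fails for $\varepsilon=0$: there is no constant $C(0)>0$ for which it holds for all $J=J(\{a_j\},\{b_j\},\{c_j\})$ with $a_jc_j\ne0$ for all $j$ and $J-J_0$ of trace class. -/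

import Mathlib

open Filter Topology
open scoped ENNReal lp ComplexInnerProductSpace

noncomputable section

namespace JacobiLT

/-! Sequences `(x_j)_{j ≥ 1}` are indexed from `0`: the entry `x_{j+1}` is the value at `j : ℕ`.
The Hilbert space is `ℓ²(ℕ, ℂ)`, and bounded complex sequences are the elements of
`ℓ^∞(ℕ, ℂ)`. -/

/-- The diagonal operator `(D_d u)_k = d_k u_k` of a bounded sequence `d`. -/
def diagOp (d : ℓ^∞(ℕ, ℂ)) : ℓ²(ℕ, ℂ) →L[ℂ] ℓ²(ℕ, ℂ) :=
  have hd : ∀ k, ‖d k‖ ≤ ‖d‖ := fun k => lp.norm_apply_le_norm ENNReal.top_ne_zero d k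
  have hmem : ∀ u : ℓ²(ℕ, ℂ), Memℓp (fun k => d k * u k) 2 := fun u =>
    ((lp.memℓp u).const_mul (‖d‖ : ℂ)).mono' (F := fun _ => ℂ) fun k => by
      rw [norm_mul, norm_mul, Complex.norm_real, norm_norm]
      exact mul_le_mul_of_nonneg_right (hd k) (norm_nonneg _)
  LinearMap.mkContinuous
    { toFun := fun u => ⟨fun k => d k * u k, hmem u⟩
      map_add' := fun u v => lp.ext (funext fun k => by
        change d k * (u k + v k) = d k * u k + d k * v k
        ring)
      map_smul' := fun c u => lp.ext (funext fun k => by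
        change d k * (c * u k) = c * (d k * u k)
        ring) }
    ‖d‖ fun u => by
      have h := lp.norm_mono (p := 2) (by norm_num)
        (x := (⟨fun k => d k * u k, hmem u⟩ : ℓ²(ℕ, ℂ))) (y := (‖d‖ : ℂ) • u) fun k => by
          change ‖d k * u k‖ ≤ ‖(‖d‖ : ℂ) * u k‖
          rw [norm_mul, norm_mul, Complex.norm_real, norm_norm]
          exact mul_le_mul_of_nonneg_right (hd k) (norm_nonneg _)
      rw [norm_smul, Complex.norm_real, norm_norm] at h
      exact h

theorem diagOp_apply (d : ℓ^∞(ℕ, ℂ)) (u : ℓ²(ℕ, ℂ)) (k : ℕ) : diagOp d u k = d k * u k := rfl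

/-- The sequence `(0, u_1, u_2, …)`. -/
def shiftSeq (u : ℕ → ℂ) : ℕ → ℂ
  | 0 => 0
  | k + 1 => u k

theorem hasSum_shiftSeq (u : ℓ²(ℕ, ℂ)) :
    HasSum (fun k => ‖shiftSeq u k‖ ^ (2 : ℝ≥0∞).toReal) (‖u‖ ^ (2 : ℝ≥0∞).toReal) := by
  have h := lp.hasSum_norm (p := 2) (by norm_num) u
  rw [← hasSum_nat_add_iff' 1]
  simpa [shiftSeq] using h

/-- The right shift `(S u)_1 = 0`, `(S u)_{k+1} = u_k`. -/
def shiftOp : ℓ²(ℕ, ℂ) →L[ℂ] ℓ²(ℕ, ℂ) :=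
  LinearMap.mkContinuous
    { toFun := fun u => ⟨shiftSeq u, memℓp_gen (hasSum_shiftSeq u).summable⟩
      map_add' := fun u v => lp.ext (funext fun k => by
        cases k with
        | zero => exact (add_zero (0 : ℂ)).symm
        | succ k => rfl)
      map_smul' := fun c u => lp.ext (funext fun k => by
        cases k with
        | zero => exact (mul_zero c).symm
        | succ k => rfl) }
    1 fun u => by
      rw [one_mul]
      exact lp.norm_le_of_tsum_le (p := 2) (by norm_num) (norm_nonneg _)
        (hasSum_shiftSeq u).tsum_eq.le

theorem shiftOp_apply_zero (u : ℓ²(ℕ, ℂ)) : shiftOp u 0 = 0 := rfl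

theorem shiftOp_apply_succ (u : ℓ²(ℕ, ℂ)) (k : ℕ) : shiftOp u (k + 1) = u k := rfl

theorem adjoint_shiftOp_apply (u : ℓ²(ℕ, ℂ)) (k : ℕ) :
    ContinuousLinearMap.adjoint shiftOp u k = u (k + 1) := by
  have hs : shiftOp (lp.single 2 k (1 : ℂ)) = lp.single 2 (k + 1) (1 : ℂ) := by
    refine lp.ext (funext fun j => ?_)
    cases j with
    | zero => rw [shiftOp_apply_zero, lp.single_apply_ne _ _ _ (by omega)]
    | succ j =>
      rw [shiftOp_apply_succ]
      by_cases h : j = k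
      · subst h
        rw [lp.single_apply_self, lp.single_apply_self]
      · rw [lp.single_apply_ne _ _ _ h, lp.single_apply_ne _ _ _ (by omega)]
  have h1 := lp.inner_single_left (𝕜 := ℂ) k (1 : ℂ) (ContinuousLinearMap.adjoint shiftOp u)
  have h2 := lp.inner_single_left (𝕜 := ℂ) (k + 1) (1 : ℂ) u
  rw [ContinuousLinearMap.adjoint_inner_right, hs, h2] at h1
  simpa using h1.symm

/-- The Jacobi operator `J({a_j}, {b_j}, {c_j})` on `ℓ²(ℕ)`, given by the tridiagonal matrix with
diagonal `b_1, b_2, …`, lower diagonal `a_1, a_2, …` and upper diagonal `c_1, c_2, …`. -/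
def jacobi (a b c : ℓ^∞(ℕ, ℂ)) : ℓ²(ℕ, ℂ) →L[ℂ] ℓ²(ℕ, ℂ) :=
  shiftOp ∘L diagOp a + diagOp b + diagOp c ∘L ContinuousLinearMap.adjoint shiftOp

theorem jacobi_apply_zero (a b c : ℓ^∞(ℕ, ℂ)) (u : ℓ²(ℕ, ℂ)) :
    jacobi a b c u 0 = b 0 * u 0 + c 0 * u 1 := by
  change shiftOp (diagOp a u) 0 + diagOp b u 0
    + diagOp c (ContinuousLinearMap.adjoint shiftOp u) 0 = _
  rw [shiftOp_apply_zero, diagOp_apply, diagOp_apply, adjoint_shiftOp_apply, zero_add]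

theorem jacobi_apply_succ (a b c : ℓ^∞(ℕ, ℂ)) (u : ℓ²(ℕ, ℂ)) (k : ℕ) :
    jacobi a b c u (k + 1) = a k * u k + b (k + 1) * u (k + 1) + c (k + 1) * u (k + 2) := by
  change shiftOp (diagOp a u) (k + 1) + diagOp b u (k + 1)
    + diagOp c (ContinuousLinearMap.adjoint shiftOp u) (k + 1) = _
  rw [shiftOp_apply_succ, diagOp_apply, diagOp_apply, diagOp_apply, adjoint_shiftOp_apply]

/-- The free Jacobi operator (discrete Laplacian) `J_0 = J({1}, {0}, {1})`. -/
def freeJacobi : ℓ²(ℕ, ℂ) →L[ℂ] ℓ²(ℕ, ℂ) := jacobi 1 0 1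

/-- The step potential `b_1 = … = b_n = ih`, `b_j = 0` for `j ≥ n + 1`. -/
def stepPotential (n : ℕ) (h : ℝ) : ℓ^∞(ℕ, ℂ) :=
  ⟨fun j => if j < n then Complex.I * h else 0, memℓp_infty ⟨|h|, by
    rintro _ ⟨j, rfl⟩
    dsimp only
    split_ifs <;> simp⟩⟩

/-- The discrete Schrödinger operator `J_{n,h} = J_0 + i h P_n`. -/
def stepJacobi (n : ℕ) (h : ℝ) : ℓ²(ℕ, ℂ) →L[ℂ] ℓ²(ℕ, ℂ) := jacobi 1 (stepPotential n h) 1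

/-- The discrete spectrum: the set of isolated points of the spectrum that are eigenvalues of
finite algebraic multiplicity (the dimension of the root subspace `⋃ₖ ker (A - z)ᵏ`). -/
def discreteSpectrum (A : ℓ²(ℕ, ℂ) →L[ℂ] ℓ²(ℕ, ℂ)) : Set ℂ :=
  {z | (∃ r > 0, Metric.ball z r ∩ spectrum ℂ A = {z}) ∧
    Module.End.HasEigenvalue (A : Module.End ℂ ℓ²(ℕ, ℂ)) z ∧
    FiniteDimensional ℂ (Module.End.maxGenEigenspace (A : Module.End ℂ ℓ²(ℕ, ℂ)) z)}

/-- The absolute value `|A| = (A* A)^{1/2}` of a bounded operator on a Hilbert space. -/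
def absOp {H : Type*} [NormedAddCommGroup H] [InnerProductSpace ℂ H] [CompleteSpace H]
    (A : H →L[ℂ] H) : H →L[ℂ] H :=
  CFC.abs A

/-- The trace norm `‖A‖₁ = tr |A| = ∑ⱼ ⟨|A| e_j, e_j⟩ ∈ [0, ∞]`, where `|A| = (A* A)^{1/2}` and
`(e_j)` is the standard basis of `ℓ²(ℕ)`. The operator `A` is of trace class iff it is finite. -/
def traceNorm (A : ℓ²(ℕ, ℂ) →L[ℂ] ℓ²(ℕ, ℂ)) : ℝ≥0∞ :=
  ∑' j : ℕ, ENNReal.ofReal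
    (⟪absOp A (lp.single 2 j (1 : ℂ)), (lp.single 2 j (1 : ℂ) : ℓ²(ℕ, ℂ))⟫).re

/-- The segment `[-2, 2]` of the real line in `ℂ`. -/
def segmentTwo : Set ℂ := (fun x : ℝ => (x : ℂ)) '' Set.Icc (-2) 2

/-- The sum `∑ dist(z, [-2,2]) / |z² - 4|^{(1-ε)/2} ∈ [0, ∞]` over the points `z` of the discrete
spectrum of `A`, each point being counted once. -/
def eigenvalueSum (ε : ℝ) (A : ℓ²(ℕ, ℂ) →L[ℂ] ℓ²(ℕ, ℂ)) : ℝ≥0∞ :=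
  ∑' z : discreteSpectrum A,
    ENNReal.ofReal (Metric.infDist (z : ℂ) segmentTwo / ‖(z : ℂ) ^ 2 - 4‖ ^ ((1 - ε) / 2))

/-- The Lieb–Thirring inequality with exponent `ε`: there is a constant `C > 0` with
`∑ dist(z, [-2,2]) / |z² - 4|^{(1-ε)/2} ≤ C ∑_{j ≥ 1} (|b_j| + |1 - a_j c_j|)`, the sum on the left
being over `σ_d(J)`, for all Jacobi operators `J = J({a_j}, {b_j}, {c_j})` with `a_j c_j ≠ 0` and
`J - J_0` of trace class. -/
def LiebThirring (ε : ℝ) : Prop :=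
  ∃ C : ℝ, 0 < C ∧ ∀ a b c : ℓ^∞(ℕ, ℂ), (∀ j, a j * c j ≠ 0) →
    traceNorm (jacobi a b c - freeJacobi) < ∞ →
    eigenvalueSum ε (jacobi a b c) ≤
      ENNReal.ofReal C * ∑' j : ℕ, ENNReal.ofReal (‖b j‖ + ‖1 - a j * c j‖)

end JacobiLT

end

noncomputable section

namespace JacobiLT

/-! Write `h = n^{-α}` and `λ = 2 cos θ + ih`. On the first `n` sites the solution of the eigenvalue
equation vanishing at site `0` is `sin(kθ)`; beyond them a square-summable solution is a multiple of
`z^k` with `z + 1/z = λ` and `|z| < 1`. The two pieces fit together iff `z = sin((n+1)θ)/sin(nθ)`,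
and then `z + 1/z = λ` becomes the quantisation condition `sin²θ = ih sin(nθ) sin((n+1)θ)`.

When `exp(-2n Im θ)` is small, the product of sines is close to `-exp(-i(2n+1)θ)/4`, so the
condition reads approximately `exp(-i(2n+1)θ) = 4i sin²θ/h`. With `x_j = (2πj - π/2)/(2n+1)` its
approximate roots are `x_j + i log(4 sin²x_j/h)/(2n+1)`, and a quantitative open mapping theorem
puts a true root near each (`exists_solution_near`) as long as `h` is small against `sin²x_j` and
`log(1/h)` is small against `hn`. The root moves `2 cos θ` off the real axis by at most `h/2`, so
`Im λ ≥ h/2`, while `|λ² - 4|^{1/2} ≤ 3 sin x_j`. Each such eigenvalue contributes at least `h/(6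
sin x_j) ≥ hn/(24j)` (`exists_eigenvalue_near`).

The admissible `j` run from about `n^{1-α/2}` to `n/2`. The harmonic sum over them is of order
`(α/2) log n`, and the trace norm is `nh`, so the quotient grows like `log n`.

That these eigenvalues lie in the discrete spectrum follows from `Im J = hP_n`, whose trace is `nh`.
This bounds the imaginary part of the trace of `J` on every finite-dimensional invariant subspace,
hence both the number of eigenvalues above any height `δ > 0` and the algebraic multiplicities; the
Fredholm alternative excludes other spectrum in the upper half plane. -/

/-! ### The step perturbation of the free operator -/

theorem stepPotential_apply (n : ℕ) (h : ℝ) (k : ℕ) :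
    stepPotential n h k = if k < n then Complex.I * h else 0 := rfl

theorem freeJacobi_eq : freeJacobi = shiftOp + ContinuousLinearMap.adjoint shiftOp := by
  ext u k
  cases k with
  | zero =>
    rw [freeJacobi, jacobi_apply_zero]
    simp [shiftOp_apply_zero, adjoint_shiftOp_apply]
  | succ k =>
    rw [freeJacobi, jacobi_apply_succ]
    simp [shiftOp_apply_succ, adjoint_shiftOp_apply]

theorem isSelfAdjoint_freeJacobi : IsSelfAdjoint freeJacobi := by
  rw [freeJacobi_eq, ← ContinuousLinearMap.star_eq_adjoint]
  exact IsSelfAdjoint.add_star_self _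

theorem stepJacobi_eq (n : ℕ) (h : ℝ) :
    stepJacobi n h = freeJacobi + diagOp (stepPotential n h) := by
  ext u k
  cases k with
  | zero =>
    simp only [stepJacobi, freeJacobi, jacobi_apply_zero, add_apply,
      lp.coeFn_add, Pi.add_apply, diagOp_apply, lp.coeFn_zero, Pi.zero_apply]
    ring
  | succ k =>
    simp only [stepJacobi, freeJacobi, jacobi_apply_succ, add_apply,
      lp.coeFn_add, Pi.add_apply, diagOp_apply, lp.coeFn_zero, Pi.zero_apply]
    ring

theorem inner_diagOp_stepPotential (n : ℕ) (h : ℝ) (x : ℓ²(ℕ, ℂ)) :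
    ⟪x, diagOp (stepPotential n h) x⟫ =
      Complex.I * (h * ∑ k ∈ Finset.range n, ‖x k‖ ^ 2 : ℝ) := by
  rw [lp.inner_eq_tsum, tsum_eq_sum (s := Finset.range n)]
  · push_cast
    rw [Finset.mul_sum, Finset.mul_sum]
    refine Finset.sum_congr rfl fun k hk => ?_
    rw [diagOp_apply, stepPotential_apply, if_pos (Finset.mem_range.1 hk), RCLike.inner_apply,
      mul_assoc, mul_assoc, Complex.mul_conj, Complex.normSq_eq_norm_sq]
    push_cast
    ring
  · intro k hk
    rw [diagOp_apply, stepPotential_apply, if_neg (fun h => hk (Finset.mem_range.2 h))]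
    simp

/-! ### Trace bounds on invariant subspaces -/

theorem im_inner_stepJacobi (n : ℕ) (h : ℝ) (x : ℓ²(ℕ, ℂ)) :
    (⟪x, stepJacobi n h x⟫).im = h * ∑ k ∈ Finset.range n, ‖x k‖ ^ 2 := by
  have h0 : (⟪x, freeJacobi x⟫).im = 0 := by
    have := (ContinuousLinearMap.isSelfAdjoint_iff_isSymmetric.1
      isSelfAdjoint_freeJacobi).im_inner_self_apply x
    simpa using this
  rw [stepJacobi_eq, add_apply, inner_add_right, Complex.add_im, h0,
    inner_diagOp_stepPotential, Complex.I_mul_im, Complex.ofReal_re, zero_add]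

/-- The imaginary part of the trace of `J_{n,h}` on a finite-dimensional invariant subspace is at
most `n h`, the trace of its imaginary part. -/
theorem im_trace_restrict_le (n : ℕ) {h : ℝ} (hh : 0 ≤ h) (W : Submodule ℂ ℓ²(ℕ, ℂ))
    [FiniteDimensional ℂ W]
    (hW : ∀ x ∈ W, (stepJacobi n h : Module.End ℂ ℓ²(ℕ, ℂ)) x ∈ W) :
    (LinearMap.trace ℂ W (LinearMap.restrict _ hW)).im ≤ h * n := by
  have e := stdOrthonormalBasis ℂ W
  have he : Orthonormal ℂ fun i => (e i : ℓ²(ℕ, ℂ)) :=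
    e.orthonormal.comp_linearIsometry W.subtypeₗᵢ
  rw [LinearMap.trace_eq_sum_inner _ e, Complex.im_sum]
  have h1 : ∀ i, (⟪e i, LinearMap.restrict _ hW (e i)⟫).im =
      h * ∑ k ∈ Finset.range n, ‖(e i : ℓ²(ℕ, ℂ)) k‖ ^ 2 := fun i =>
    im_inner_stepJacobi n h (e i)
  simp_rw [h1, ← Finset.mul_sum]
  rw [Finset.sum_comm]
  refine mul_le_mul_of_nonneg_left ?_ hh
  calc _ ≤ ∑ k ∈ Finset.range n, (1 : ℝ) := Finset.sum_le_sum fun k _ => by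
        -- Bessel's inequality for the `k`-th basis vector: the squared `k`-th coordinates of an
        -- orthonormal family sum to at most `1`.
        have := he.sum_inner_products_le (lp.single 2 k (1 : ℂ) : ℓ²(ℕ, ℂ)) (s := Finset.univ)
        simpa [lp.inner_single_right, lp.norm_single] using this
    _ = n := by simp

/-- Eigenvectors for `N` distinct eigenvalues span an invariant subspace on which the trace is the
sum of these eigenvalues. Its imaginary part is at least `Nδ` and at most `hn`, which bounds `N`. -/
theorem finite_eigenvalues_im_gt (n : ℕ) {h : ℝ} (hh : 0 ≤ h) {δ : ℝ} (hδ : 0 < δ) :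
    {z : ℂ | Module.End.HasEigenvalue (stepJacobi n h : Module.End ℂ ℓ²(ℕ, ℂ)) z ∧
      δ < z.im}.Finite := by
  classical
  by_contra hinf
  obtain ⟨N, hN⟩ := exists_nat_gt (h * n / δ)
  obtain ⟨s, hs, hcard⟩ := Set.Infinite.exists_subset_card_eq hinf N
  choose v hv using fun z : s => (hs z.2).1.exists_hasEigenvector
  have hli : LinearIndependent ℂ v :=
    Module.End.eigenvectors_linearIndependent' _ (fun z : s => (z : ℂ))
      Subtype.val_injective v hv
  set W := Submodule.span ℂ (Set.range v)
  have hW : ∀ x ∈ W, (stepJacobi n h : Module.End ℂ ℓ²(ℕ, ℂ)) x ∈ W := by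
    intro x hx
    induction hx using Submodule.span_induction with
    | mem x hx =>
      obtain ⟨z, rfl⟩ := hx
      rw [(hv z).apply_eq_smul]
      exact W.smul_mem _ (Submodule.subset_span ⟨z, rfl⟩)
    | zero => rw [map_zero]; exact W.zero_mem
    | add x y _ _ hx hy => rw [map_add]; exact W.add_mem hx hy
    | smul c x _ hx => rw [map_smul]; exact W.smul_mem _ hx
  let B : Module.Basis s ℂ W := Module.Basis.span hli
  have : FiniteDimensional ℂ W := B.finiteDimensional_of_finite
  have htr : LinearMap.trace ℂ W (LinearMap.restrict _ hW) = ∑ z : s, (z : ℂ) := by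
    rw [LinearMap.trace_eq_matrix_trace ℂ B, Matrix.trace]
    refine Finset.sum_congr rfl fun z _ => ?_
    have hz : LinearMap.restrict _ hW (B z) = (z : ℂ) • B z := by
      apply Subtype.ext
      rw [LinearMap.coe_restrict_apply, Submodule.coe_smul, Module.Basis.span_apply,
        (hv z).apply_eq_smul]
    rw [Matrix.diag_apply, LinearMap.toMatrix_apply, hz, map_smul]
    simp
  have h1 := im_trace_restrict_le n hh W hW
  rw [htr, Complex.im_sum] at h1
  have h2 : ∑ z : s, δ ≤ ∑ z : s, (z : ℂ).im :=
    Finset.sum_le_sum fun z _ => (hs z.2).2.le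
  rw [Finset.sum_const, Finset.card_univ, Fintype.card_coe, hcard, nsmul_eq_mul] at h2
  rw [div_lt_iff₀ hδ] at hN
  linarith

/-- On `W` the operator is `z` plus a nilpotent, so its trace there is `z dim W`. -/
theorem finrank_le_of_invariant_of_nilpotent (n : ℕ) {h : ℝ} (hh : 0 ≤ h) {z : ℂ}
    (W : Submodule ℂ ℓ²(ℕ, ℂ)) [FiniteDimensional ℂ W]
    (hW : ∀ x ∈ W, ((stepJacobi n h : Module.End ℂ ℓ²(ℕ, ℂ)) - z • 1) x ∈ W) (m : ℕ)
    (hm : ∀ x ∈ W, (((stepJacobi n h : Module.End ℂ ℓ²(ℕ, ℂ)) - z • 1) ^ m) x = 0) :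
    Module.finrank ℂ W * z.im ≤ h * n := by
  have hW' : ∀ x ∈ W, (stepJacobi n h : Module.End ℂ ℓ²(ℕ, ℂ)) x ∈ W := by
    intro x hx
    have := W.add_mem (hW x hx) (W.smul_mem z hx)
    simpa using this
  have hnil : IsNilpotent (LinearMap.restrict _ hW) := ⟨m, by
    rw [Module.End.pow_restrict]
    exact LinearMap.ext fun x => Subtype.ext (hm x x.2)⟩
  have heq : LinearMap.restrict _ hW' = LinearMap.restrict _ hW + z • 1 := by
    apply LinearMap.ext
    intro x
    apply Subtype.ext
    simp
  have h1 := im_trace_restrict_le n hh W hW'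
  rw [heq, map_add, (LinearMap.isNilpotent_trace_of_isNilpotent hnil).eq_zero, map_smul,
    LinearMap.trace_one, zero_add] at h1
  simpa [mul_comm] using h1

theorem finiteDimensional_maxGenEigenspace_stepJacobi (n : ℕ) {h : ℝ} (hh : 0 ≤ h) {z : ℂ}
    (hz : 0 < z.im) :
    FiniteDimensional ℂ (Module.End.maxGenEigenspace
      (stepJacobi n h : Module.End ℂ ℓ²(ℕ, ℂ)) z) := by
  set A : Module.End ℂ ℓ²(ℕ, ℂ) := (stepJacobi n h : Module.End ℂ ℓ²(ℕ, ℂ)) with hA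
  obtain ⟨N, hN⟩ := exists_nat_gt (h * n / z.im)
  have key : Module.rank ℂ (Module.End.maxGenEigenspace A z) ≤ N := by
    refine rank_le fun s hs => ?_
    have hs' := hs.map' (Module.End.maxGenEigenspace A z).subtype (Submodule.ker_subtype _)
    choose k hk using fun x : Module.End.maxGenEigenspace A z =>
      (Module.End.mem_maxGenEigenspace A z x).1 x.2
    set m := s.sup k
    set v : s → ℓ²(ℕ, ℂ) := fun x => ((x : Module.End.maxGenEigenspace A z) : ℓ²(ℕ, ℂ))
    set f : Module.End ℂ ℓ²(ℕ, ℂ) := A - z • 1 with hf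
    have hv : ∀ x, (f ^ m) (v x) = 0 := fun x => by
      have : m = (m - k x) + k x := (Nat.sub_add_cancel (Finset.le_sup x.2)).symm
      rw [this, pow_add, Module.End.mul_apply, hk, map_zero]
    set W : Submodule ℂ ℓ²(ℕ, ℂ) := Submodule.span ℂ (Set.range v)
    have hfin : FiniteDimensional ℂ W := FiniteDimensional.span_of_finite ℂ (Set.finite_range v)
    have hWm : ∀ x ∈ W, (f ^ m) x = 0 := by
      have : W ≤ LinearMap.ker (f ^ m) := Submodule.span_le.2 (by
        rintro _ ⟨x, rfl⟩
        exact hv x)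
      exact fun x hx => this hx
    -- The span `W` need not be invariant under `f`. The sum of its images under `f^0, …, f^m` is,
    -- because `f^m` kills `W`.
    set V : Submodule ℂ ℓ²(ℕ, ℂ) := ⨆ i : Fin (m + 1), W.map (f ^ (i : ℕ))
    have hVm : ∀ x ∈ V, (f ^ m) x = 0 := by
      have : V ≤ LinearMap.ker (f ^ m) := iSup_le fun i => by
        rintro _ ⟨x, hx, rfl⟩
        rw [LinearMap.mem_ker, ← Module.End.mul_apply, ← pow_add, add_comm, pow_add,
          Module.End.mul_apply, hWm x hx, map_zero]
      exact fun x hx => this hx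
    have hVf : ∀ x ∈ V, f x ∈ V := by
      have : V ≤ V.comap f := iSup_le fun i => by
        rintro _ ⟨x, hx, rfl⟩
        rw [Submodule.mem_comap, ← Module.End.mul_apply, ← pow_succ']
        by_cases hi : (i : ℕ) < m
        · exact Submodule.mem_iSup_of_mem (⟨i + 1, by omega⟩ : Fin (m + 1))
            (Submodule.mem_map_of_mem hx)
        · have : (i : ℕ) + 1 = 1 + m := by omega
          rw [this, pow_add, Module.End.mul_apply, hWm x hx, map_zero]
          exact V.zero_mem
      exact fun x hx => this hx
    have hWV : W ≤ V := fun x hx =>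
      Submodule.mem_iSup_of_mem (0 : Fin (m + 1)) ⟨x, hx, by simp⟩
    have h1 := finrank_le_of_invariant_of_nilpotent n hh V hVf m hVm
    have h2 : s.card = Module.finrank ℂ W := by
      rw [finrank_span_eq_card (b := v) hs', Fintype.card_coe]
    have h3 := Submodule.finrank_mono hWV
    have h4 : (s.card : ℝ) * z.im ≤ Module.finrank ℂ V * z.im :=
      mul_le_mul_of_nonneg_right (by rw [h2]; exact_mod_cast h3) hz.le
    rw [div_lt_iff₀ hz] at hN
    have h5 : (s.card : ℝ) * z.im < N * z.im := by linarith
    exact_mod_cast (lt_of_mul_lt_mul_right h5 hz.le).le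
  exact Module.rank_lt_aleph0_iff.1 (key.trans_lt Cardinal.natCast_lt_aleph0)

/-! ### Spectrum in the upper half plane -/

theorem isCompactOperator_diagOp_stepPotential (n : ℕ) (h : ℝ) :
    IsCompactOperator (diagOp (stepPotential n h)) := by
  have key : diagOp (stepPotential n h) = ∑ k ∈ Finset.range n,
      (ContinuousLinearMap.toSpanSingleton ℂ (lp.single 2 k (Complex.I * h) : ℓ²(ℕ, ℂ))) ∘L
        (innerSL ℂ (lp.single 2 k (1 : ℂ) : ℓ²(ℕ, ℂ))) := by
    ext u j
    have h1 : ∀ k, (ContinuousLinearMap.toSpanSingleton ℂ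
        (lp.single 2 k (Complex.I * h) : ℓ²(ℕ, ℂ)) ∘L
        (innerSL ℂ (lp.single 2 k (1 : ℂ) : ℓ²(ℕ, ℂ)))) u =
        u k • (lp.single 2 k (Complex.I * h) : ℓ²(ℕ, ℂ)) := fun k => by
      simp [lp.inner_single_left, ContinuousLinearMap.toSpanSingleton_apply]
    rw [diagOp_apply, stepPotential_apply, sum_apply,
      Finset.sum_congr rfl fun k _ => h1 k, lp.coeFn_sum, Finset.sum_apply]
    simp only [lp.coeFn_smul, Pi.smul_apply, lp.coeFn_single, Pi.single_apply, smul_eq_mul,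
      mul_ite, mul_zero, Finset.sum_ite_eq, Finset.mem_range, ite_mul, zero_mul]
    simp only [mul_comm]
  rw [key]
  refine Submodule.sum_mem (compactOperator (RingHom.id ℂ) ℓ²(ℕ, ℂ) ℓ²(ℕ, ℂ)) fun k _ => ?_
  have hc : IsCompactOperator (innerSL ℂ (lp.single 2 k (1 : ℂ) : ℓ²(ℕ, ℂ))) :=
    isCompactOperator_of_locallyCompactSpace_dom _
  exact hc.clm_comp (ContinuousLinearMap.toSpanSingleton ℂ
    (lp.single 2 k (Complex.I * h) : ℓ²(ℕ, ℂ)))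

/-- A point of the open upper half plane is an eigenvalue of `J_{n,h}` or a regular point. -/
theorem hasEigenvalue_of_mem_spectrum_stepJacobi (n : ℕ) (h : ℝ) {z : ℂ} (hz : 0 < z.im)
    (hs : z ∈ spectrum ℂ (stepJacobi n h)) :
    Module.End.HasEigenvalue (stepJacobi n h : Module.End ℂ ℓ²(ℕ, ℂ)) z := by
  have hreg : IsUnit (algebraMap ℂ (ℓ²(ℕ, ℂ) →L[ℂ] ℓ²(ℕ, ℂ)) z - freeJacobi) := by
    by_contra hu
    have := isSelfAdjoint_freeJacobi.mem_spectrum_eq_re (z := z) hu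
    have h2 := congrArg Complex.im this
    simp at h2
    exact hz.ne' h2
  obtain ⟨U, hU⟩ := hreg
  set F := diagOp (stepPotential n h)
  have hK : IsCompactOperator ((↑U⁻¹ : ℓ²(ℕ, ℂ) →L[ℂ] ℓ²(ℕ, ℂ)) ∘L F) :=
    (isCompactOperator_diagOp_stepPotential n h).clm_comp _
  -- Since `z - J = (z - J₀)(1 - (z - J₀)⁻¹F)` with `z - J₀` invertible, the Fredholm alternative
  -- for the compact `(z - J₀)⁻¹F` at `1` decides between eigenvalue and regular point.
  rcases IsCompactOperator.hasEigenvalue_or_mem_resolventSet hK (μ := (1 : ℂ)) one_ne_zero with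
    he | hr
  · obtain ⟨v, hv⟩ := he.exists_hasEigenvector
    refine Module.End.hasEigenvalue_of_hasEigenvector (x := v) ⟨?_, hv.2⟩
    rw [Module.End.mem_eigenspace_iff]
    have h1 : (↑U⁻¹ : ℓ²(ℕ, ℂ) →L[ℂ] ℓ²(ℕ, ℂ)) (F v) = v := by
      simpa using hv.apply_eq_smul
    have h2 : F v = (U : ℓ²(ℕ, ℂ) →L[ℂ] ℓ²(ℕ, ℂ)) v := by
      conv_rhs => rw [← h1]
      rw [← mul_apply_eq_comp, U.mul_inv]
      rfl
    rw [hU] at h2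
    change stepJacobi n h v = z • v
    rw [stepJacobi_eq, add_apply]
    change freeJacobi v + F v = _
    rw [h2]
    simp [Algebra.algebraMap_eq_smul_one]
  · exfalso
    apply hs
    have h1 : algebraMap ℂ (ℓ²(ℕ, ℂ) →L[ℂ] ℓ²(ℕ, ℂ)) z - stepJacobi n h =
        U * (algebraMap ℂ _ 1 - ↑U⁻¹ * F) := by
      rw [stepJacobi_eq, mul_sub, ← mul_assoc, U.mul_inv, hU, map_one, mul_one, one_mul]
      abel
    rw [spectrum.mem_resolventSet_iff] at hr ⊢
    rw [h1]
    exact U.isUnit.mul hr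

/-- Above height `Im z / 2` the spectrum consists of finitely many eigenvalues, so `z` is isolated.
-/
theorem mem_discreteSpectrum_stepJacobi (n : ℕ) {h : ℝ} (hh : 0 ≤ h) {z : ℂ} (hz : 0 < z.im)
    (he : Module.End.HasEigenvalue (stepJacobi n h : Module.End ℂ ℓ²(ℕ, ℂ)) z) :
    z ∈ discreteSpectrum (stepJacobi n h) := by
  refine ⟨?_, he, finiteDimensional_maxGenEigenspace_stepJacobi n hh hz⟩
  have hfin := finite_eigenvalues_im_gt n hh (half_pos hz)
  set S := {w : ℂ | Module.End.HasEigenvalue (stepJacobi n h : Module.End ℂ ℓ²(ℕ, ℂ)) w ∧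
      z.im / 2 < w.im}
  have hopen : IsOpen ((S \ {z})ᶜ ∩ {w : ℂ | z.im / 2 < w.im}) :=
    (hfin.subset Set.sdiff_subset).isClosed.isOpen_compl.inter
      (isOpen_lt continuous_const Complex.continuous_im)
  obtain ⟨r, hr, hball⟩ := Metric.isOpen_iff.1 hopen z ⟨fun h => h.2 rfl, half_lt_self hz⟩
  refine ⟨r, hr, Set.Subset.antisymm ?_ ?_⟩
  · rintro w ⟨hw, hws⟩
    obtain ⟨h1, h2⟩ := hball hw
    by_contra hne
    have h2' : z.im / 2 < w.im := h2
    exact h1 ⟨⟨hasEigenvalue_of_mem_spectrum_stepJacobi n h ((half_pos hz).trans h2') hws, h2⟩,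
      hne⟩
  · rintro _ rfl
    refine ⟨Metric.mem_ball_self hr, ?_⟩
    rw [ContinuousLinearMap.spectrum_eq]
    exact he.mem_spectrum

/-! ### The trace norm of the perturbation -/

theorem absOp_I_smul {H : Type*} [NormedAddCommGroup H] [InnerProductSpace ℂ H] [CompleteSpace H]
    {T : H →L[ℂ] H} (hT : 0 ≤ T) : absOp (Complex.I • T) = T := by
  rw [absOp, CFC.abs_smul, CFC.abs_of_nonneg T hT]
  simp

theorem absOp_diagOp_stepPotential (n : ℕ) {h : ℝ} (hh : 0 ≤ h) :
    absOp (diagOp (stepPotential n h)) = (-Complex.I) • diagOp (stepPotential n h) := by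
  set T := (-Complex.I) • diagOp (stepPotential n h) with hT
  have hin : ∀ x, ⟪x, T x⟫ = (h * ∑ k ∈ Finset.range n, ‖x k‖ ^ 2 : ℝ) := fun x => by
    rw [hT, smul_apply, inner_smul_right, inner_diagOp_stepPotential, ← mul_assoc, neg_mul,
      Complex.I_mul_I, neg_neg, one_mul]
  have hpos : 0 ≤ T := by
    rw [ContinuousLinearMap.nonneg_iff_isPositive, ContinuousLinearMap.isPositive_iff_complex]
    intro x
    have h1 : ⟪T x, x⟫ = (h * ∑ k ∈ Finset.range n, ‖x k‖ ^ 2 : ℝ) := by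
      rw [← inner_conj_symm, hin, Complex.conj_ofReal]
    rw [h1]
    change ((h * ∑ k ∈ Finset.range n, ‖x k‖ ^ 2 : ℝ) : ℂ) = _ ∧
      0 ≤ h * ∑ k ∈ Finset.range n, ‖x k‖ ^ 2
    exact ⟨rfl, mul_nonneg hh (Finset.sum_nonneg fun k _ => sq_nonneg _)⟩
  have hD : diagOp (stepPotential n h) = Complex.I • T := by
    rw [hT, smul_smul]
    simp
  rw [hD, absOp_I_smul hpos]

theorem traceNorm_stepJacobi_sub_freeJacobi (n : ℕ) {h : ℝ} (hh : 0 ≤ h) :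
    traceNorm (stepJacobi n h - freeJacobi) = ENNReal.ofReal (n * h) := by
  rw [stepJacobi_eq, add_sub_cancel_left, traceNorm, absOp_diagOp_stepPotential n hh,
    tsum_eq_sum (s := Finset.range n)]
  · have h1 : ∀ j ∈ Finset.range n, ENNReal.ofReal
        (⟪((-Complex.I) • diagOp (stepPotential n h)) (lp.single 2 j (1 : ℂ)),
          (lp.single 2 j (1 : ℂ) : ℓ²(ℕ, ℂ))⟫).re = ENNReal.ofReal h := fun j hj => by
      rw [lp.inner_single_right, smul_apply, lp.coeFn_smul, Pi.smul_apply, diagOp_apply,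
        stepPotential_apply, if_pos (Finset.mem_range.1 hj), lp.single_apply_self]
      simp
    rw [Finset.sum_congr rfl h1, Finset.sum_const, Finset.card_range, nsmul_eq_mul,
      ENNReal.ofReal_mul (Nat.cast_nonneg n), ENNReal.ofReal_natCast]
  · intro j hj
    rw [lp.inner_single_right, smul_apply, lp.coeFn_smul, Pi.smul_apply, diagOp_apply,
      stepPotential_apply, if_neg fun h => hj (Finset.mem_range.2 h)]
    simp

/-! ### The quantisation condition -/

/-- The solution of the eigenvalue equation matching `sin (k θ)` on the first sites with the
decaying exponential `z ^ k`. -/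
theorem hasEigenvalue_stepJacobi_of_matching (p : ℕ) (h : ℝ) {θ z : ℂ}
    (hθ : Complex.sin θ ≠ 0) (hz : ‖z‖ < 1) (hz0 : z ≠ 0)
    (hmatch : Complex.sin ((p + 2) * θ) = z * Complex.sin ((p + 1) * θ))
    (hlam : z + z⁻¹ = 2 * Complex.cos θ + Complex.I * h) :
    Module.End.HasEigenvalue (stepJacobi (p + 1) h : Module.End ℂ ℓ²(ℕ, ℂ))
      (2 * Complex.cos θ + Complex.I * h) := by
  -- Index `k` stands for site `k + 1`, and `p + 1` is the length of the step. The sine formula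
  -- persists at `k = p + 1` by matching and the geometric one holds already at `k = p`; with this
  -- overlap every row of the equation involves a single formula.
  set u : ℕ → ℂ := fun k => if k ≤ p then Complex.sin ((k + 1) * θ) else
    Complex.sin ((p + 1) * θ) * z ^ (k - p) with hu
  have hu1 : ∀ k ≤ p + 1, u k = Complex.sin ((k + 1) * θ) := by
    intro k hk
    rcases Nat.lt_or_ge p k with h1 | h1
    · obtain rfl : k = p + 1 := by omega
      simp only [hu]
      rw [if_neg (by omega), Nat.add_sub_cancel_left, pow_one, mul_comm, ← hmatch]
      push_cast
      ring_nf
    · simp only [hu]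
      rw [if_pos h1]
  have hu2 : ∀ m, u (p + m) = Complex.sin ((p + 1) * θ) * z ^ m := by
    intro m
    rcases Nat.eq_zero_or_pos m with rfl | h1
    · simp [hu]
    · simp only [hu]
      rw [if_neg (by omega), Nat.add_sub_cancel_left]
  have hmem : Memℓp u 2 := by
    refine memℓp_gen ?_
    rw [← summable_nat_add_iff p]
    have : (fun m => ‖u (m + p)‖ ^ (2 : ℝ≥0∞).toReal) =
        fun m => ‖Complex.sin ((p + 1) * θ)‖ ^ 2 * (‖z‖ ^ 2) ^ m := by
      funext m
      rw [add_comm, hu2, ENNReal.toReal_ofNat, Real.rpow_ofNat, norm_mul, norm_pow]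
      ring
    rw [this]
    exact (summable_geometric_of_lt_one (sq_nonneg _)
      (pow_lt_one₀ (norm_nonneg _) hz two_ne_zero)).mul_left _
  have hsin : ∀ x : ℂ, Complex.sin (x * θ) + Complex.sin ((x + 2) * θ) =
      2 * Complex.cos θ * Complex.sin ((x + 1) * θ) := by
    intro x
    have h1 : x * θ = (x + 1) * θ - θ := by ring
    have h2 : (x + 2) * θ = (x + 1) * θ + θ := by ring
    rw [h1, h2, Complex.sin_sub, Complex.sin_add]
    ring
  set U : ℓ²(ℕ, ℂ) := ⟨u, hmem⟩
  refine Module.End.hasEigenvalue_of_hasEigenvector (x := U) ⟨?_, fun h0 => ?_⟩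
  · rw [Module.End.mem_eigenspace_iff]
    refine lp.ext (funext fun k => ?_)
    change stepJacobi (p + 1) h U k = (2 * Complex.cos θ + Complex.I * h) * u k
    cases k with
    | zero =>
      rw [stepJacobi, jacobi_apply_zero, stepPotential_apply, if_pos (Nat.succ_pos p)]
      change _ * u 0 + 1 * u 1 = _
      rw [hu1 0 (by omega), hu1 1 (by omega)]
      have := hsin 0
      simp only [zero_mul, Complex.sin_zero, zero_add] at this
      push_cast
      rw [show ((1 : ℂ) + 1) = 2 by norm_num, this]
      simp only [zero_add]
      ring
    | succ k =>
      rw [stepJacobi, jacobi_apply_succ, stepPotential_apply]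
      change 1 * u k + _ * u (k + 1) + 1 * u (k + 2) = _
      rcases Nat.lt_or_ge k p with h1 | h1
      · rw [if_pos (by omega), hu1 k (by omega), hu1 (k + 1) (by omega), hu1 (k + 2) (by omega)]
        have := hsin (k + 1)
        push_cast
        rw [show (k : ℂ) + 1 + 2 = k + 2 + 1 by ring] at this
        linear_combination this
      · rw [if_neg (by omega)]
        obtain ⟨m, rfl⟩ := Nat.exists_eq_add_of_le h1
        rw [hu2, add_assoc p m, hu2, add_assoc p m, hu2, ← hlam]
        field_simp
        ring
  · have h1 : u 0 = 0 := congrArg (fun v : ℓ²(ℕ, ℂ) => v 0) h0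
    rw [hu1 0 (by omega)] at h1
    apply hθ
    simpa using h1

/-- The quadratic invariant of the recurrence satisfied by `sin(kθ)`; it turns `z + 1/z = λ` into
the quantisation condition. -/
theorem sin_sq_eq_of_consecutive (a θ : ℂ) :
    Complex.sin (a + θ) ^ 2 + Complex.sin a ^ 2 -
      2 * Complex.cos θ * Complex.sin a * Complex.sin (a + θ) = Complex.sin θ ^ 2 := by
  rw [Complex.sin_add]
  linear_combination (Complex.sin θ ^ 2) * Complex.sin_sq_add_cos_sq a
    - (Complex.sin a ^ 2) * Complex.sin_sq_add_cos_sq θ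

/-- `Im(z + 1/z) = Im z (1 - 1/|z|²)`, so opposite signs force `|z| < 1`. Decay of the eigenvector
is thus read off from the sign of an imaginary part. -/
theorem norm_lt_one_of_im_neg {z : ℂ} (hz : z.im < 0) (h : 0 < (z + z⁻¹).im) : ‖z‖ < 1 := by
  have hz0 : z ≠ 0 := by
    rintro rfl
    simp at hz
  rw [Complex.add_im, Complex.inv_im, Complex.normSq_eq_norm_sq] at h
  have hp : 0 < ‖z‖ ^ 2 := by positivity
  by_contra! hc
  have h1 : 1 ≤ ‖z‖ ^ 2 := one_le_pow₀ hc
  have h2 : -z.im / ‖z‖ ^ 2 ≤ -z.im := div_le_self (by linarith) h1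
  linarith

theorem hasEigenvalue_stepJacobi_of_sin_sq_eq {n : ℕ} (hn : 0 < n) {h : ℝ} {θ : ℂ}
    (hθ : Complex.sin θ ≠ 0)
    (heq : Complex.sin θ ^ 2 =
      Complex.I * h * (Complex.sin (n * θ) * Complex.sin ((n + 1) * θ)))
    (him : 0 < (2 * Complex.cos θ + Complex.I * h).im)
    (hz : (Complex.sin ((n + 1) * θ) / Complex.sin (n * θ)).im < 0) :
    Module.End.HasEigenvalue (stepJacobi n h : Module.End ℂ ℓ²(ℕ, ℂ))
      (2 * Complex.cos θ + Complex.I * h) := by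
  have hne : Complex.sin (n * θ) * Complex.sin ((n + 1) * θ) ≠ 0 := fun h0 => by
    rw [h0, mul_zero] at heq
    exact hθ (pow_eq_zero_iff two_ne_zero |>.1 heq)
  obtain ⟨h1, h2⟩ := mul_ne_zero_iff.1 hne
  have hlam : Complex.sin ((n + 1) * θ) / Complex.sin (n * θ) +
      (Complex.sin ((n + 1) * θ) / Complex.sin (n * θ))⁻¹ =
      2 * Complex.cos θ + Complex.I * h := by
    have := sin_sq_eq_of_consecutive (n * θ) θ
    rw [heq, show (n : ℂ) * θ + θ = (n + 1) * θ by ring] at this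
    field_simp
    linear_combination this
  obtain ⟨p, rfl⟩ := Nat.exists_eq_succ_of_ne_zero hn.ne'
  refine hasEigenvalue_stepJacobi_of_matching p h hθ
    (norm_lt_one_of_im_neg hz (hlam ▸ him)) (div_ne_zero h2 h1) ?_ hlam
  rw [show ((p : ℂ) + 1) = ((p + 1 : ℕ) : ℂ) by push_cast; ring,
    show ((p : ℂ) + 2) = ((p.succ : ℕ) : ℂ) + 1 by push_cast; ring]
  exact (div_mul_cancel₀ _ h1).symm

/-! ### Sines and cosines near the real axis, and their exponential forms -/

theorem norm_exp_I_mul_sub_le {a d : ℂ} (hd : ‖d‖ ≤ 1) :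
    ‖Complex.exp (Complex.I * (a + d)) - Complex.exp (Complex.I * a)‖ ≤
      ‖Complex.exp (Complex.I * a)‖ * (2 * ‖d‖) := by
  have h1 : Complex.exp (Complex.I * (a + d)) - Complex.exp (Complex.I * a) =
      Complex.exp (Complex.I * a) * (Complex.exp (Complex.I * d) - 1) := by
    rw [mul_add, Complex.exp_add]
    ring
  have h2 : ‖Complex.I * d‖ = ‖d‖ := by simp
  rw [h1, norm_mul]
  refine mul_le_mul_of_nonneg_left ?_ (norm_nonneg _)
  have := Complex.norm_exp_sub_one_le (x := Complex.I * d) (by rwa [h2])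
  rwa [h2] at this

theorem norm_exp_I_mul_ofReal_sub_le (x : ℝ) {θ : ℂ} (hd : ‖θ - x‖ ≤ 1) :
    ‖Complex.exp (Complex.I * θ) - Complex.exp (Complex.I * x)‖ ≤ 2 * ‖θ - x‖ := by
  have := norm_exp_I_mul_sub_le (a := x) hd
  rwa [add_sub_cancel, Complex.norm_exp_I_mul_ofReal, one_mul] at this

theorem norm_exp_neg_I_mul_ofReal_sub_le (x : ℝ) {θ : ℂ} (hd : ‖θ - x‖ ≤ 1) :
    ‖Complex.exp (-(Complex.I * θ)) - Complex.exp (-(Complex.I * x))‖ ≤ 2 * ‖θ - x‖ := by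
  have h1 : ‖-θ - ((-x : ℝ) : ℂ)‖ = ‖θ - x‖ := by
    rw [← norm_neg]
    push_cast
    ring_nf
  have := norm_exp_I_mul_ofReal_sub_le (-x) (θ := -θ) (by rwa [h1])
  rw [h1] at this
  simpa using this

theorem norm_sin_sub_sin_ofReal_le (x : ℝ) {θ : ℂ} (hd : ‖θ - x‖ ≤ 1) :
    ‖Complex.sin θ - (Real.sin x : ℂ)‖ ≤ 2 * ‖θ - x‖ := by
  have h1 := norm_exp_I_mul_ofReal_sub_le x hd
  have h2 := norm_exp_neg_I_mul_ofReal_sub_le x hd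
  have h3 : Complex.sin θ - (Real.sin x : ℂ) = Complex.I / 2 *
      ((Complex.exp (-(Complex.I * θ)) - Complex.exp (-(Complex.I * x))) -
        (Complex.exp (Complex.I * θ) - Complex.exp (Complex.I * x))) := by
    rw [Complex.ofReal_sin, Complex.sin, Complex.sin]
    ring_nf
  rw [h3, norm_mul, norm_div, Complex.norm_I, Complex.norm_ofNat]
  have := norm_sub_le (Complex.exp (-(Complex.I * θ)) - Complex.exp (-(Complex.I * x)))
    (Complex.exp (Complex.I * θ) - Complex.exp (Complex.I * x))
  linarith

theorem norm_cos_sub_cos_ofReal_le (x : ℝ) {θ : ℂ} (hd : ‖θ - x‖ ≤ 1) :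
    ‖Complex.cos θ - (Real.cos x : ℂ)‖ ≤ 2 * ‖θ - x‖ := by
  have h1 := norm_exp_I_mul_ofReal_sub_le x hd
  have h2 := norm_exp_neg_I_mul_ofReal_sub_le x hd
  have h3 : Complex.cos θ - (Real.cos x : ℂ) = 1 / 2 *
      ((Complex.exp (-(Complex.I * θ)) - Complex.exp (-(Complex.I * x))) +
        (Complex.exp (Complex.I * θ) - Complex.exp (Complex.I * x))) := by
    rw [Complex.ofReal_cos, Complex.cos, Complex.cos]
    ring_nf
  rw [h3, norm_mul, norm_div, norm_one, Complex.norm_ofNat]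
  have := norm_add_le (Complex.exp (-(Complex.I * θ)) - Complex.exp (-(Complex.I * x)))
    (Complex.exp (Complex.I * θ) - Complex.exp (Complex.I * x))
  linarith

theorem sin_eq_exp_neg_mul_one_sub (y : ℂ) :
    Complex.sin y = Complex.I / 2 * (Complex.exp (-(Complex.I * y)) *
      (1 - Complex.exp (Complex.I * (2 * y)))) := by
  rw [mul_sub, ← Complex.exp_add, Complex.sin]
  ring_nf

theorem sin_mul_sin_eq_exp (n : ℕ) (θ : ℂ) :
    4 * (Complex.sin (n * θ) * Complex.sin ((n + 1) * θ)) =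
      -(Complex.exp (-(Complex.I * ((2 * n + 1) * θ))) *
        ((1 - Complex.exp (Complex.I * (2 * n * θ))) *
          (1 - Complex.exp (Complex.I * (2 * (n + 1) * θ))))) := by
  rw [sin_eq_exp_neg_mul_one_sub, sin_eq_exp_neg_mul_one_sub, show (2 : ℂ) * n * θ = 2 * (n * θ) by ring,
    show (2 : ℂ) * (n + 1) * θ = 2 * ((n + 1) * θ) by ring,
    show -(Complex.I * ((2 * n + 1) * θ)) =
      -(Complex.I * (n * θ)) + -(Complex.I * ((n + 1) * θ)) by ring, Complex.exp_add]
  linear_combination Complex.exp (-(Complex.I * (n * θ))) *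
    (1 - Complex.exp (Complex.I * (2 * (n * θ)))) *
    (Complex.exp (-(Complex.I * ((n + 1) * θ))) *
      (1 - Complex.exp (Complex.I * (2 * ((n + 1) * θ))))) * Complex.I_sq

/-- Splits the matching ratio into its main term `exp(-iθ)` and a correction controlled by
`exp(2inθ)`. -/
theorem sin_div_sin_eq_exp (n : ℕ) {θ : ℂ} (hs : Complex.exp (Complex.I * (2 * n * θ)) ≠ 1) :
    Complex.sin ((n + 1) * θ) / Complex.sin (n * θ) = Complex.exp (-(Complex.I * θ)) -
      2 * Complex.I * Complex.sin θ * Complex.exp (Complex.I * (2 * n * θ)) /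
        (1 - Complex.exp (Complex.I * (2 * n * θ))) := by
  have h1 : 1 - Complex.exp (Complex.I * (2 * n * θ)) ≠ 0 := sub_ne_zero.2 hs.symm
  rw [sin_eq_exp_neg_mul_one_sub (n * θ), sin_eq_exp_neg_mul_one_sub ((n + 1) * θ),
    sin_eq_exp_neg_mul_one_sub θ, show (2 : ℂ) * (n * θ) = 2 * n * θ by ring,
    show -(Complex.I * ((n + 1) * θ)) = -(Complex.I * (n * θ)) + -(Complex.I * θ) by ring,
    show Complex.I * (2 * ((n + 1) * θ)) = Complex.I * (2 * n * θ) + Complex.I * (2 * θ) by ring,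
    Complex.exp_add, Complex.exp_add]
  have h2 := Complex.exp_ne_zero (-(Complex.I * (n * θ)))
  generalize Complex.exp (Complex.I * (2 * n * θ)) = q at *
  generalize Complex.exp (Complex.I * (2 * θ)) = w
  generalize Complex.exp (-(Complex.I * (n * θ))) = a at *
  have hI := Complex.I_ne_zero
  field_simp
  linear_combination q * (1 - w) * Complex.I_sq

/-! ### Solving the quantisation condition near its approximate roots -/

/-- A zero of an entire function in a disc, from a lower bound for its oscillation on the circle. -/
theorem exists_zero_of_le_norm_sub {f : ℂ → ℂ} (hf : Differentiable ℂ f) {c : ℂ} {r ε : ℝ}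
    (hr : 0 < r) (hε : ∀ z ∈ Metric.sphere c r, ε ≤ ‖f z - f c‖) (hc : ‖f c‖ < ε / 2) :
    ∃ z ∈ Metric.closedBall c r, f z = 0 := by
  have hfreq : ∃ᶠ z in 𝓝 c, f z ≠ f c := by
    intro hev
    have hconst : f = fun _ => f c :=
      (hf.differentiableOn.analyticOnNhd isOpen_univ |>.mono (Set.subset_univ _)
        |>.eq_of_eventuallyEq (z₀ := c) (fun z _ => analyticAt_const) (by
          filter_upwards [hev] with z hz
          exact not_not.1 hz))
    have h1 := hε (c + r) (by simp [abs_of_pos hr])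
    rw [hconst] at h1
    simp only [sub_self, norm_zero] at h1
    linarith [norm_nonneg (f c)]
  have := hf.diffContOnCl.ball_subset_image_closedBall hr hε hfreq
  obtain ⟨z, hz, hz0⟩ := this (show (0 : ℂ) ∈ _ by simpa using hc)
  exact ⟨z, hz, hz0⟩

theorem norm_exp_I_mul (z : ℂ) : ‖Complex.exp (Complex.I * z)‖ = Real.exp (-z.im) := by
  rw [Complex.norm_exp, Complex.I_mul_re]

/-- `hY` keeps the whole disc within `h/8` of `x`, which later costs at most half of `Im λ`. `hhs`
makes the logarithm exceed `1/2`, hence `Im θ ≥ 0`, and makes `exp(2inθ)` negligible. -/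
theorem near_center_bounds {n : ℕ} {x h : ℝ} (hs : 0 < Real.sin x) (hh : 0 < h)
    (hhs : 1000 * h ≤ Real.sin x ^ 2)
    (hY : 8 * (Real.log (4 * Real.sin x ^ 2 / h) + 1) ≤ h * (2 * n + 1)) {θ : ℂ}
    (hθ : ‖θ - (x + Complex.I * (Real.log (4 * Real.sin x ^ 2 / h) / (2 * n + 1) : ℝ))‖ ≤
      1 / (2 * (2 * n + 1))) :
    ‖θ - x‖ ≤ h / 8 ∧ 0 ≤ θ.im ∧ ‖Complex.exp (Complex.I * (2 * n * θ))‖ ≤ 1 / 1000 := by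
  set N : ℝ := 2 * n + 1 with hN
  have hNpos : 0 < N := by positivity
  set l := Real.log (4 * Real.sin x ^ 2 / h) with hl
  have hratio : 4000 ≤ 4 * Real.sin x ^ 2 / h := by
    rw [le_div_iff₀ hh]
    linarith
  have hl1 : 1 / 2 ≤ l := by
    have h1 := Real.one_sub_inv_le_log_of_pos (x := 4 * Real.sin x ^ 2 / h) (by linarith)
    have h2 : (4 * Real.sin x ^ 2 / h)⁻¹ ≤ 4000⁻¹ := inv_anti₀ (by norm_num) hratio
    have h3 : (4000 : ℝ)⁻¹ ≤ 1 / 2 := by norm_num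
    linarith
  have hYN : (l + 1) / N ≤ h / 8 := by
    rw [div_le_iff₀ hNpos]
    linarith
  have him : |θ.im - l / N| ≤ 1 / (2 * N) := by
    have := (Complex.abs_im_le_norm _).trans hθ
    simpa using this
  have hhalf : 1 / (2 * N) = (1 / 2) / N := by
    field_simp
  have hs1 : Real.sin x ^ 2 ≤ 1 := Real.sin_sq_le_one x
  obtain ⟨him1, him2⟩ := abs_le.1 him
  have him0 : 0 ≤ θ.im := by
    have : (1 / 2) / N ≤ l / N := div_le_div_of_nonneg_right hl1 hNpos.le
    linarith
  have hsum : l / N + (1 / 2) / N ≤ h / 8 := by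
    rw [← add_div]
    refine le_trans (div_le_div_of_nonneg_right ?_ hNpos.le) hYN
    linarith
  refine ⟨?_, him0, ?_⟩
  · have h1 : θ - x = (θ - (x + Complex.I * (l / N : ℝ))) + Complex.I * (l / N : ℝ) := by ring
    rw [h1]
    refine (norm_add_le _ _).trans ?_
    have h2 : ‖Complex.I * ((l / N : ℝ) : ℂ)‖ = l / N := by
      rw [norm_mul, Complex.norm_I, one_mul, Complex.norm_real, Real.norm_eq_abs, abs_of_nonneg]
      positivity
    rw [h2]
    linarith
  · rw [norm_exp_I_mul]
    have h1 : (2 * (n : ℂ) * θ).im = (2 * n) * θ.im := by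
      rw [show (2 * (n : ℂ) * θ) = ((2 * n : ℝ) : ℂ) * θ by push_cast; ring, Complex.im_ofReal_mul]
    rw [h1]
    -- One half of the `1` pays for the radius of the disc, the other for replacing `2n + 1` by
    -- `2n`.
    have h2 : -(2 * n * θ.im) ≤ 1 + -l := by
      have h3 : N * (l / N - (1 / 2) / N) ≤ N * θ.im :=
        mul_le_mul_of_nonneg_left (by linarith) hNpos.le
      have h4 : N * (l / N - (1 / 2) / N) = l - 1 / 2 := by field_simp
      have h5 : 2 * n * θ.im = N * θ.im - θ.im := by rw [hN]; ring
      linarith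
    refine (Real.exp_le_exp.2 h2).trans ?_
    rw [Real.exp_add, Real.exp_neg, hl, Real.exp_log (by linarith)]
    have h6 : Real.exp 1 ≤ 4 := by linarith [Real.exp_one_lt_d9]
    have h7 : (4 * Real.sin x ^ 2 / h)⁻¹ ≤ 4000⁻¹ := inv_anti₀ (by norm_num) hratio
    calc Real.exp 1 * (4 * Real.sin x ^ 2 / h)⁻¹ ≤ 4 * 4000⁻¹ :=
          mul_le_mul h6 h7 (by positivity) (by norm_num)
      _ = 1 / 1000 := by norm_num

theorem norm_sin_sq_div_sub_one_le {x h : ℝ} (hs : 0 < Real.sin x) (hh : 0 < h)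
    (hhs : 1000 * h ≤ Real.sin x ^ 2) {θ : ℂ} (hd : ‖θ - x‖ ≤ h / 8) :
    ‖Complex.sin θ ^ 2 / (Real.sin x : ℂ) ^ 2 - 1‖ ≤ 1 / 1000 := by
  set s := Real.sin x
  have hs1 : s ≤ 1 := Real.sin_le_one x
  have hhs' : 1000 * h ≤ s := by nlinarith
  have h1 := norm_sin_sub_sin_ofReal_le x (θ := θ) (by linarith)
  have hsc : (s : ℂ) ≠ 0 := by exact_mod_cast hs.ne'
  set e := (Complex.sin θ - s) / s with he
  have hen : ‖e‖ ≤ 1 / 4000 := by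
    rw [he, norm_div, Complex.norm_real, Real.norm_eq_abs, abs_of_pos hs, div_le_iff₀ hs]
    change ‖Complex.sin θ - s‖ ≤ _ at h1
    linarith
  have h2 : Complex.sin θ ^ 2 / (s : ℂ) ^ 2 - 1 = e * (2 + e) := by
    rw [he]
    field_simp
    ring
  rw [h2, norm_mul]
  have h3 : ‖2 + e‖ ≤ 3 := (norm_add_le _ _).trans (by rw [Complex.norm_ofNat]; linarith)
  calc ‖e‖ * ‖2 + e‖ ≤ 1 / 4000 * 3 := mul_le_mul hen h3 (norm_nonneg _) (by norm_num)
    _ ≤ 1 / 1000 := by norm_num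

theorem norm_one_sub_mul_one_sub_sub_one_le {q q' : ℂ} {ε : ℝ} (hε : ε ≤ 1) (hq : ‖q‖ ≤ ε)
    (hq' : ‖q'‖ ≤ ε) : ‖(1 - q) * (1 - q') - 1‖ ≤ 3 * ε := by
  have h1 : (1 - q) * (1 - q') - 1 = q * q' - q - q' := by ring
  have h2 : ‖q * q'‖ ≤ ε := by
    rw [norm_mul]
    have := mul_le_mul hq (hq'.trans hε) (norm_nonneg _) ((norm_nonneg _).trans hq)
    simpa using this
  rw [h1]
  linarith [norm_sub_le (q * q' - q) q', norm_sub_le (q * q') q]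

/-- Divided by `sin²x`, the condition becomes `A P = R`, where `A = exp(-i(2n+1)(θ - c))` and both
`P` and `R` are close to `1` on the disc. As `A c = 1`, the function `A P - R` is nearly zero at the
centre, while on the boundary circle it inherits the oscillation of `A`. -/
theorem exists_solution_near {n : ℕ} {x h : ℝ} (hs : 0 < Real.sin x) (hh : 0 < h)
    (hhs : 1000 * h ≤ Real.sin x ^ 2)
    (hY : 8 * (Real.log (4 * Real.sin x ^ 2 / h) + 1) ≤ h * (2 * n + 1))
    (hx : Complex.exp (-(Complex.I * ((2 * n + 1) * x))) = Complex.I) :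
    ∃ θ : ℂ,
      ‖θ - (x + Complex.I * (Real.log (4 * Real.sin x ^ 2 / h) / (2 * n + 1) : ℝ))‖ ≤
        1 / (2 * (2 * n + 1)) ∧
      Complex.sin θ ^ 2 =
        Complex.I * h * (Complex.sin (n * θ) * Complex.sin ((n + 1) * θ)) := by
  set c : ℂ := x + Complex.I * (Real.log (4 * Real.sin x ^ 2 / h) / (2 * n + 1) : ℝ) with hc
  set r : ℝ := 1 / (2 * (2 * n + 1)) with hr
  have hrpos : 0 < r := by positivity
  have hN0 : (2 * (n : ℂ) + 1) ≠ 0 := by exact_mod_cast (by positivity : (2 * n + 1 : ℕ) ≠ 0)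
  set A : ℂ → ℂ := fun θ => Complex.exp (-(Complex.I * ((2 * n + 1) * (θ - c)))) with hA
  set P : ℂ → ℂ := fun θ => (1 - Complex.exp (Complex.I * (2 * n * θ))) *
          (1 - Complex.exp (Complex.I * (2 * (n + 1) * θ))) with hP
  set R : ℂ → ℂ := fun θ => Complex.sin θ ^ 2 / (Real.sin x : ℂ) ^ 2 with hR
  have hsc : (Real.sin x : ℂ) ≠ 0 := by exact_mod_cast hs.ne'
  have hbR : ∀ θ, ‖θ - c‖ ≤ r → ‖R θ - 1‖ ≤ 1 / 1000 := fun θ hθ =>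
    norm_sin_sq_div_sub_one_le hs hh hhs (near_center_bounds hs hh hhs hY hθ).1
  have hbP : ∀ θ, ‖θ - c‖ ≤ r → ‖P θ - 1‖ ≤ 3 * (1 / 1000) := fun θ hθ => by
    obtain ⟨-, h1, h2⟩ := near_center_bounds hs hh hhs hY hθ
    refine norm_one_sub_mul_one_sub_sub_one_le (by norm_num) h2 (le_trans ?_ h2)
    rw [norm_exp_I_mul, norm_exp_I_mul, Real.exp_le_exp, neg_le_neg_iff]
    have e1 : (2 * (n : ℂ) * θ).im = (2 * n) * θ.im := by
      rw [show (2 * (n : ℂ) * θ) = ((2 * n : ℝ) : ℂ) * θ by push_cast; ring, Complex.im_ofReal_mul]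
    have e2 : (2 * ((n : ℂ) + 1) * θ).im = (2 * (n + 1)) * θ.im := by
      rw [show (2 * ((n : ℂ) + 1) * θ) = ((2 * (n + 1) : ℝ) : ℂ) * θ by push_cast; ring,
        Complex.im_ofReal_mul]
    rw [e1, e2]
    nlinarith
  have hu : ∀ θ, ‖θ - c‖ ≤ r → ‖-(Complex.I * ((2 * n + 1) * (θ - c)))‖ ≤ 1 / 2 := fun θ hθ => by
    have : ‖(2 * (n : ℂ) + 1)‖ = 2 * n + 1 := by
      rw [show (2 * (n : ℂ) + 1) = ((2 * n + 1 : ℕ) : ℂ) by push_cast; ring, Complex.norm_natCast]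
      push_cast
      ring
    rw [norm_neg, norm_mul, Complex.norm_I, one_mul, norm_mul, this]
    calc (2 * (n : ℝ) + 1) * ‖θ - c‖ ≤ (2 * n + 1) * r :=
          mul_le_mul_of_nonneg_left hθ (by positivity)
      _ = 1 / 2 := by rw [hr]; field_simp
  have hbA : ∀ θ, ‖θ - c‖ ≤ r → ‖A θ‖ ≤ 2 := fun θ hθ => by
    have h1 := hu θ hθ
    have h2 := Complex.norm_exp_sub_one_le (h1.trans (by norm_num))
    have h3 := norm_add_le (A θ - 1) 1
    rw [sub_add_cancel, norm_one] at h3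
    change ‖A θ - 1‖ ≤ _ at h2
    linarith
  have hAc : A c = 1 := by simp [hA]
  have hfc : ‖A c * P c - R c‖ ≤ 1 / 100 := by
    have h0 : ‖c - c‖ ≤ r := by simpa using hrpos.le
    have h1 : A c * P c - R c = (P c - 1) - (R c - 1) := by rw [hAc]; ring
    rw [h1]
    linarith [norm_sub_le (P c - 1) (R c - 1), hbP c h0, hbR c h0]
  have hlow : ∀ θ ∈ Metric.sphere c r, 1 / 5 ≤ ‖(A θ * P θ - R θ) - (A c * P c - R c)‖ := by
    intro θ hθ
    have hθ' : ‖θ - c‖ = r := mem_sphere_iff_norm.1 hθ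
    have hθr := hθ'.le
    have h1 : ‖-(Complex.I * ((2 * n + 1) * (θ - c)))‖ = 1 / 2 := by
      refine le_antisymm (hu θ hθr) ?_
      have : ‖(2 * (n : ℂ) + 1)‖ = 2 * n + 1 := by
        rw [show (2 * (n : ℂ) + 1) = ((2 * n + 1 : ℕ) : ℂ) by push_cast; ring,
          Complex.norm_natCast]
        push_cast
        ring
      rw [norm_neg, norm_mul, Complex.norm_I, one_mul, norm_mul, this, hθ', hr]
      apply le_of_eq
      field_simp
    -- `|e^u - 1| ≥ |u| - |u|²` with `|u| = 1/2`.
    have h2 : 1 / 4 ≤ ‖A θ - 1‖ := by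
      have h3 := Complex.norm_exp_sub_one_sub_id_le (h1.le.trans (by norm_num))
      rw [h1] at h3
      have h4 := norm_sub_norm_le (-(Complex.I * ((2 * n + 1) * (θ - c))))
        (-(A θ - 1 - -(Complex.I * ((2 * n + 1) * (θ - c)))))
      rw [norm_neg (A θ - 1 - _), h1,
        show ∀ a b : ℂ, a - -(b - a) = b by intros; ring] at h4
      change ‖A θ - 1 - _‖ ≤ _ at h3
      linarith
    have h5 : ‖A θ * (P θ - 1)‖ ≤ 2 * (3 * (1 / 1000)) := by
      rw [norm_mul]
      exact mul_le_mul (hbA θ hθr) (hbP θ hθr) (norm_nonneg _) (by norm_num)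
    have h6 : A θ - 1 = ((A θ * P θ - R θ) - (A c * P c - R c)) + (A c * P c - R c)
        - A θ * (P θ - 1) + (R θ - 1) := by ring
    have h7 : ‖A θ - 1‖ ≤ ‖(A θ * P θ - R θ) - (A c * P c - R c)‖ + ‖A c * P c - R c‖
        + ‖A θ * (P θ - 1)‖ + ‖R θ - 1‖ := by
      conv_lhs => rw [h6]
      refine (norm_add_le _ _).trans (add_le_add_left ?_ _)
      exact (norm_sub_le _ _).trans (add_le_add_left (norm_add_le _ _) _)
    linarith [hbR θ hθr]
  have hdiff : Differentiable ℂ fun θ => A θ * P θ - R θ := by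
    simp only [hA, hP, hR]
    fun_prop
  obtain ⟨θ, hθ, hzero⟩ := exists_zero_of_le_norm_sub hdiff hrpos hlow
    (hfc.trans_lt (by norm_num))
  refine ⟨θ, mem_closedBall_iff_norm.1 hθ, ?_⟩
  have hAθ : A θ = Complex.exp (-(Complex.I * ((2 * n + 1) * θ))) *
      (-Complex.I * (h / (4 * (Real.sin x : ℂ) ^ 2))) := by
    have h1 : Complex.exp (-(Complex.I * ((2 * n + 1) * c))) =
        Complex.I * (4 * (Real.sin x : ℂ) ^ 2 / h) := by
      have h2 : -(Complex.I * ((2 * n + 1) * c)) = -(Complex.I * ((2 * n + 1) * x)) +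
          (Real.log (4 * Real.sin x ^ 2 / h) : ℂ) := by
        rw [hc]
        push_cast
        field_simp
        ring_nf
        rw [Complex.I_sq]
        ring
      rw [h2, Complex.exp_add, hx, ← Complex.ofReal_exp, Real.exp_log (by positivity)]
      push_cast
      ring
    have h3 : A θ * Complex.exp (-(Complex.I * ((2 * n + 1) * c))) =
        Complex.exp (-(Complex.I * ((2 * n + 1) * θ))) := by
      rw [hA, ← Complex.exp_add]
      ring_nf
    have hhc : (h : ℂ) ≠ 0 := by exact_mod_cast hh.ne'
    rw [← h3, h1]
    field_simp
    rw [Complex.I_sq]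
    ring
  have hprod := sin_mul_sin_eq_exp n θ
  have h4 : Complex.sin θ ^ 2 = A θ * P θ * (Real.sin x : ℂ) ^ 2 := by
    rw [sub_eq_zero.1 hzero]
    simp only [hR]
    field_simp
  have h5 : ∀ E Q : ℂ, E * (-Complex.I * (h / (4 * (Real.sin x : ℂ) ^ 2))) * Q *
      (Real.sin x : ℂ) ^ 2 = -(Complex.I * h / 4) * (E * Q) := fun E Q => by
    field_simp
  rw [h4, hAθ, h5]
  linear_combination -(Complex.I * h / 4) * hprod

/-! ### From roots to eigenvalues and their contributions -/

theorem im_le_infDist_segmentTwo (z : ℂ) : z.im ≤ Metric.infDist z segmentTwo := by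
  refine (Metric.le_infDist (Set.Nonempty.image _ ⟨0, by norm_num⟩)).2 ?_
  rintro _ ⟨y, -, rfl⟩
  rw [dist_eq_norm]
  have := (le_abs_self _).trans (Complex.abs_im_le_norm (z - (y : ℂ)))
  simpa using this

/-- The main term `exp(-iθ)` has imaginary part close to `-sin x`, and the correction is at most
`sin x / 2`. -/
theorem im_sin_ratio_neg {n : ℕ} {x h : ℝ} (hs : 0 < Real.sin x)
    (hhs : 1000 * h ≤ Real.sin x ^ 2) {θ : ℂ} (hd : ‖θ - x‖ ≤ h / 8)
    (hq : ‖Complex.exp (Complex.I * (2 * n * θ))‖ ≤ 1 / 1000) :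
    (Complex.sin ((n + 1) * θ) / Complex.sin (n * θ)).im < 0 := by
  have hs1 : Real.sin x ≤ 1 := Real.sin_le_one x
  have hhs' : 1000 * h ≤ Real.sin x := by nlinarith
  have hd1 : ‖θ - x‖ ≤ 1 := by linarith
  have hne : Complex.exp (Complex.I * (2 * n * θ)) ≠ 1 := fun h1 => by
    rw [h1, norm_one] at hq
    norm_num at hq
  rw [sin_div_sin_eq_exp n hne, Complex.sub_im]
  set q := Complex.exp (Complex.I * (2 * n * θ))
  have h1 : (Complex.exp (-(Complex.I * θ))).im ≤ -Real.sin x + 2 * ‖θ - x‖ := by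
    have h2 := (le_abs_self _).trans
      ((Complex.abs_im_le_norm _).trans (norm_exp_neg_I_mul_ofReal_sub_le x hd1))
    have h3 : (Complex.exp (-(Complex.I * x))).im = -Real.sin x := by
      rw [show -(Complex.I * (x : ℂ)) = ((-x : ℝ) : ℂ) * Complex.I by push_cast; ring,
        Complex.exp_ofReal_mul_I_im, Real.sin_neg]
    rw [Complex.sub_im, h3] at h2
    linarith
  have hsin : ‖Complex.sin θ‖ ≤ 2 * Real.sin x := by
    have h2 := norm_sin_sub_sin_ofReal_le x hd1
    have h3 := norm_sub_norm_le (Complex.sin θ) (Real.sin x : ℂ)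
    rw [Complex.norm_real, Real.norm_eq_abs, abs_of_pos hs] at h3
    linarith
  have hq1 : 999 / 1000 ≤ ‖1 - q‖ := by
    have := norm_sub_norm_le 1 q
    rw [norm_one] at this
    linarith
  have h4 : ‖2 * Complex.I * Complex.sin θ * q / (1 - q)‖ ≤ Real.sin x / 2 := by
    rw [norm_div, div_le_iff₀ (by linarith), norm_mul, norm_mul, norm_mul, Complex.norm_I,
      Complex.norm_ofNat, mul_one]
    calc 2 * ‖Complex.sin θ‖ * ‖q‖ ≤ 2 * (2 * Real.sin x) * (1 / 1000) :=
          mul_le_mul (by linarith) hq (norm_nonneg _) (by linarith)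
      _ ≤ Real.sin x / 2 * (999 / 1000) := by linarith
      _ ≤ _ := mul_le_mul_of_nonneg_left hq1 (by linarith)
  have h5 := (neg_abs_le _).trans' (neg_le_neg ((Complex.abs_im_le_norm _).trans h4))
  linarith

theorem exists_eigenvalue_near {n : ℕ} (hn : 0 < n) {x h : ℝ} (hs : 0 < Real.sin x) (hh : 0 < h)
    (hhs : 1000 * h ≤ Real.sin x ^ 2)
    (hY : 8 * (Real.log (4 * Real.sin x ^ 2 / h) + 1) ≤ h * (2 * n + 1))
    (hx : Complex.exp (-(Complex.I * ((2 * n + 1) * x))) = Complex.I) :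
    ∃ θ : ℂ, |θ.re - x| ≤ 1 / (2 * (2 * n + 1)) ∧
      2 * Complex.cos θ + Complex.I * h ∈ discreteSpectrum (stepJacobi n h) ∧
      h / (6 * Real.sin x) ≤
        Metric.infDist (2 * Complex.cos θ + Complex.I * h) segmentTwo /
          ‖(2 * Complex.cos θ + Complex.I * h) ^ 2 - 4‖ ^ ((1 - 0 : ℝ) / 2) := by
  obtain ⟨θ, hθ, heq⟩ := exists_solution_near hs hh hhs hY hx
  obtain ⟨hd, -, hq⟩ := near_center_bounds hs hh hhs hY hθ
  have hs1 : Real.sin x ≤ 1 := Real.sin_le_one x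
  have hhs' : 1000 * h ≤ Real.sin x := by nlinarith
  have hd1 : ‖θ - x‖ ≤ 1 := by linarith
  have hsinsub := norm_sin_sub_sin_ofReal_le x hd1
  have hcossub := norm_cos_sub_cos_ofReal_le x hd1
  have hnsin : ‖(Real.sin x : ℂ)‖ = Real.sin x := by
    rw [Complex.norm_real, Real.norm_eq_abs, abs_of_pos hs]
  have hsin0 : Complex.sin θ ≠ 0 := fun h0 => by
    rw [h0, zero_sub, norm_neg, hnsin] at hsinsub
    linarith
  have him : h / 2 ≤ (2 * Complex.cos θ + Complex.I * h).im := by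
    have h1 := (neg_abs_le _).trans' (neg_le_neg ((Complex.abs_im_le_norm _).trans hcossub))
    rw [Complex.sub_im, Complex.ofReal_im, sub_zero] at h1
    have h2 : (2 * Complex.cos θ + Complex.I * h).im = 2 * (Complex.cos θ).im + h := by
      simp
    rw [h2]
    linarith
  refine ⟨θ, ?_, ?_, ?_⟩
  · have := (Complex.abs_re_le_norm _).trans hθ
    rwa [Complex.sub_re, Complex.add_re, Complex.ofReal_re, Complex.I_mul_re, Complex.ofReal_im,
      neg_zero, add_zero] at this
  · exact mem_discreteSpectrum_stepJacobi n hh.le (by linarith)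
      (hasEigenvalue_stepJacobi_of_sin_sq_eq hn hsin0 heq (by linarith)
        (im_sin_ratio_neg hs hhs hd hq))
  · set z := 2 * Complex.cos θ + Complex.I * h with hz
    have hzne : z ^ 2 - 4 ≠ 0 := fun h0 => by
      have h1 : (z - 2) * (z + 2) = 0 := by linear_combination h0
      have h2 : z.im = 0 := by
        rcases mul_eq_zero.1 h1 with h3 | h3
        · rw [sub_eq_zero.1 h3]; simp
        · rw [eq_neg_of_add_eq_zero_left h3]; simp
      linarith
    have hsin : ‖Complex.sin θ‖ ≤ 4001 / 4000 * Real.sin x := by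
      have h3 := norm_sub_norm_le (Complex.sin θ) (Real.sin x : ℂ)
      rw [hnsin] at h3
      linarith
    have hcos : ‖Complex.cos θ‖ ≤ 2 := by
      have h3 := norm_sub_norm_le (Complex.cos θ) (Real.cos x : ℂ)
      rw [Complex.norm_real, Real.norm_eq_abs] at h3
      linarith [Real.abs_cos_le_one x]
    have hbound : ‖z ^ 2 - 4‖ ≤ (3 * Real.sin x) ^ 2 := by
      -- The leading term is `-4 sin²θ`; the other two are of order `h`, hence small against
      -- `sin²x`.
      have h1 : z ^ 2 - 4 = -(4 * Complex.sin θ ^ 2) + 4 * Complex.I * h * Complex.cos θ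
          - (h : ℂ) ^ 2 := by
        rw [hz]
        linear_combination (4 : ℂ) * Complex.sin_sq_add_cos_sq θ + (h : ℂ) ^ 2 * Complex.I_sq
      have hnh : ‖(h : ℂ)‖ = h := by
        rw [Complex.norm_real, Real.norm_eq_abs, abs_of_pos hh]
      have h2 : ‖4 * Complex.sin θ ^ 2‖ ≤ 5 * Real.sin x ^ 2 := by
        rw [norm_mul, norm_pow, Complex.norm_ofNat]
        nlinarith [pow_le_pow_left₀ (norm_nonneg _) hsin 2]
      have h3 : ‖4 * Complex.I * h * Complex.cos θ‖ ≤ 8 * h := by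
        rw [norm_mul, norm_mul, norm_mul, Complex.norm_I, Complex.norm_ofNat, hnh]
        nlinarith
      have h4 : ‖(h : ℂ) ^ 2‖ ≤ h := by
        rw [norm_pow, hnh]
        nlinarith
      rw [h1]
      have h5 := norm_sub_le (-(4 * Complex.sin θ ^ 2) + 4 * Complex.I * h * Complex.cos θ)
        ((h : ℂ) ^ 2)
      have h6 := norm_add_le (-(4 * Complex.sin θ ^ 2)) (4 * Complex.I * h * Complex.cos θ)
      rw [norm_neg] at h6
      nlinarith
    have hsqrt : ‖z ^ 2 - 4‖ ^ ((1 - 0 : ℝ) / 2) ≤ 3 * Real.sin x := by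
      rw [sub_zero, ← Real.sqrt_eq_rpow]
      exact Real.sqrt_le_iff.2 ⟨by linarith, hbound⟩
    have hpos : 0 < ‖z ^ 2 - 4‖ ^ ((1 - 0 : ℝ) / 2) := Real.rpow_pos_of_pos (norm_pos_iff.2 hzne) _
    calc h / (6 * Real.sin x) = (h / 2) / (3 * Real.sin x) := by
          field_simp
          norm_num
      _ ≤ _ := div_le_div₀ (Metric.infDist_nonneg) (him.trans (im_le_infDist_segmentTwo z))
          hpos hsqrt

/-! ### The quasimomenta and the distinctness of the eigenvalues -/

/-- The approximate quasimomentum of the `j`-th eigenvalue of `J_{n,h}`. -/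
def quasimomentum (n j : ℕ) : ℝ := (2 * Real.pi * j - Real.pi / 2) / (2 * n + 1)

theorem exp_quasimomentum (n j : ℕ) :
    Complex.exp (-(Complex.I * ((2 * n + 1) * quasimomentum n j))) = Complex.I := by
  have hN : (2 * (n : ℂ) + 1) ≠ 0 := by exact_mod_cast (by positivity : (2 * n + 1 : ℕ) ≠ 0)
  have h1 : -(Complex.I * ((2 * n + 1) * (quasimomentum n j : ℂ))) =
      Real.pi / 2 * Complex.I + ((-(j : ℤ) : ℤ) : ℂ) * (2 * Real.pi * Complex.I) := by
    rw [quasimomentum]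
    push_cast
    field_simp
    ring
  rw [h1, Complex.exp_add, Complex.exp_int_mul_two_pi_mul_I, mul_one, Complex.exp_mul_I,
    Complex.cos_pi_div_two, Complex.sin_pi_div_two]
  simp

theorem quasimomentum_le {n j : ℕ} (hj : 2 * j ≤ n) : quasimomentum n j ≤ Real.pi / 2 := by
  have hj' : (2 : ℝ) * j ≤ n := by exact_mod_cast hj
  rw [quasimomentum, div_le_iff₀ (by positivity)]
  nlinarith [Real.pi_pos]

theorem one_div_lt_quasimomentum {n j : ℕ} (hj : 1 ≤ j) :
    1 / (2 * (2 * n + 1)) < quasimomentum n j := by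
  have hj' : (1 : ℝ) ≤ j := by exact_mod_cast hj
  have h1 : (1 : ℝ) / (2 * (2 * n + 1)) = (1 / 2) / (2 * n + 1) := by field_simp
  rw [quasimomentum, h1]
  refine div_lt_div_of_pos_right ?_ (by positivity)
  nlinarith [Real.pi_gt_three]

theorem quasimomentum_pos {n j : ℕ} (hj : 1 ≤ j) : 0 < quasimomentum n j :=
  lt_trans (by positivity) (one_div_lt_quasimomentum hj)

theorem div_le_sin_quasimomentum {n j : ℕ} (hj1 : 1 ≤ j) (hj : 2 * j ≤ n) :
    (j : ℝ) / n ≤ Real.sin (quasimomentum n j) := by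
  refine le_trans ?_ (Real.mul_le_sin (quasimomentum_pos hj1).le (quasimomentum_le hj))
  have hj' : (2 : ℝ) * j ≤ n := by exact_mod_cast hj
  have hj1' : (1 : ℝ) ≤ j := by exact_mod_cast hj1
  have h1 : 2 / Real.pi * quasimomentum n j = (4 * j - 1) / (2 * n + 1) := by
    rw [quasimomentum]
    field_simp [Real.pi_ne_zero]
    ring
  rw [h1, div_le_div_iff₀ (by linarith) (by positivity)]
  nlinarith

theorem sin_quasimomentum_le {n j : ℕ} (hj1 : 1 ≤ j) (hn : 0 < n) :
    Real.sin (quasimomentum n j) ≤ 4 * j / n := by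
  refine (Real.sin_le (quasimomentum_pos hj1).le).trans ?_
  have hn' : (0 : ℝ) < n := by exact_mod_cast hn
  have hj1' : (1 : ℝ) ≤ j := by exact_mod_cast hj1
  rw [quasimomentum, div_le_div_iff₀ (by positivity) hn']
  have h2 : 2 * Real.pi * j - Real.pi / 2 ≤ 8 * j := by nlinarith [Real.pi_le_four, Real.pi_pos]
  nlinarith

/-- Consecutive quasimomenta are `2π/(2n+1)` apart, more than the two disc radii together. -/
theorem eq_of_abs_quasimomentum_sub_le {n i j : ℕ}
    (h : |quasimomentum n i - quasimomentum n j| ≤ 1 / (2 * n + 1)) : i = j := by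
  have h1 : quasimomentum n i - quasimomentum n j =
      2 * Real.pi * ((i : ℤ) - (j : ℤ) : ℤ) / (2 * n + 1) := by
    rw [quasimomentum, quasimomentum]
    push_cast
    ring
  have hN : (0 : ℝ) < 2 * n + 1 := by positivity
  rw [h1, abs_div, abs_of_pos hN, div_le_div_iff_of_pos_right hN, abs_mul,
    abs_of_pos Real.two_pi_pos, ← Int.cast_abs] at h
  by_contra hne
  have h2 : (1 : ℤ) ≤ |(i : ℤ) - j| := Int.one_le_abs (by omega)
  have h3 : (1 : ℝ) ≤ (|(i : ℤ) - j| : ℤ) := by exact_mod_cast h2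
  nlinarith [Real.pi_gt_three]

theorem eq_of_cos_eq_cos_near_quasimomentum {n i j : ℕ} (hi1 : 1 ≤ i) (hi : 2 * i ≤ n)
    (hj1 : 1 ≤ j) (hj : 2 * j ≤ n) {θ φ : ℂ}
    (hθ : |θ.re - quasimomentum n i| ≤ 1 / (2 * (2 * n + 1)))
    (hφ : |φ.re - quasimomentum n j| ≤ 1 / (2 * (2 * n + 1)))
    (h : Complex.cos θ = Complex.cos φ) : i = j := by
  have hr : (1 : ℝ) / (2 * (2 * n + 1)) ≤ 1 / 2 := by
    refine one_div_le_one_div_of_le two_pos ?_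
    have : (0 : ℝ) ≤ n := Nat.cast_nonneg n
    linarith
  have hbi := quasimomentum_le hi
  have hbj := quasimomentum_le hj
  have hpi := one_div_lt_quasimomentum (n := n) hi1
  have hpj := one_div_lt_quasimomentum (n := n) hj1
  obtain ⟨hθ1, hθ2⟩ := abs_le.1 hθ
  obtain ⟨hφ1, hφ2⟩ := abs_le.1 hφ
  have hπ := Real.pi_gt_three
  obtain ⟨k, hk | hk⟩ := Complex.cos_eq_cos_iff.1 h
  · have h1 := congrArg Complex.re hk
    have h2 : φ.re = 2 * k * Real.pi + θ.re := by simpa using h1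
    have hk0 : k = 0 := by
      have h3 : (k : ℝ) < 1 := by
        by_contra! hc
        nlinarith
      have h4 : (-1 : ℝ) < k := by
        by_contra! hc
        nlinarith
      have h3' : k < 1 := by exact_mod_cast h3
      have h4' : -1 < k := by exact_mod_cast h4
      omega
    rw [hk0] at h2
    simp only [Int.cast_zero, mul_zero, zero_mul, zero_add] at h2
    apply eq_of_abs_quasimomentum_sub_le (n := n)
    have h5 : (1 : ℝ) / (2 * n + 1) = 1 / (2 * (2 * n + 1)) + 1 / (2 * (2 * n + 1)) := by
      field_simp
      norm_num
    rw [h5, abs_le]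
    constructor <;> linarith
  -- Here `Re θ + Re φ` would be a multiple of `2π`, but it is positive and at most `π + 1 < 2π`.
  · exfalso
    have h1 := congrArg Complex.re hk
    have h2 : φ.re = 2 * k * Real.pi - θ.re := by simpa using h1
    have h3 : (k : ℝ) < 1 := by
      by_contra! hc
      nlinarith
    have h4 : (0 : ℝ) < k := by
      by_contra! hc
      nlinarith
    have h3' : k < 1 := by exact_mod_cast h3
    have h4' : 0 < k := by exact_mod_cast h4
    omega

/-! ### Summation and asymptotics -/

/-- For `j ≥ m` one has `sin²x_j ≥ (j/n)² ≥ 1000h`, and `j ≤ n/2` keeps `x_j` below `π/2`; each such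
`j` yields its own eigenvalue. -/
theorem sum_le_eigenvalueSum_stepJacobi {n m : ℕ} (hn : 0 < n) (hm : 1 ≤ m) {h : ℝ} (hh : 0 < h)
    (hmh : 1000 * h * n ^ 2 ≤ m ^ 2)
    (hY : 8 * (Real.log (4 / h) + 1) ≤ h * (2 * n + 1)) :
    ENNReal.ofReal (∑ j ∈ Finset.Ico m (n / 2 + 1), h * n / 24 * (1 / j)) ≤
      eigenvalueSum 0 (stepJacobi n h) := by
  have hn' : (0 : ℝ) < n := by exact_mod_cast hn
  have key : ∀ j : Finset.Ico m (n / 2 + 1), ∃ θ : ℂ,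
      |θ.re - quasimomentum n j| ≤ 1 / (2 * (2 * n + 1)) ∧
      2 * Complex.cos θ + Complex.I * h ∈ discreteSpectrum (stepJacobi n h) ∧
      h * n / 24 * (1 / (j : ℕ)) ≤
        Metric.infDist (2 * Complex.cos θ + Complex.I * h) segmentTwo /
          ‖(2 * Complex.cos θ + Complex.I * h) ^ 2 - 4‖ ^ ((1 - 0 : ℝ) / 2) := by
    rintro ⟨j, hj⟩
    obtain ⟨hmj, hjn⟩ := Finset.mem_Ico.1 hj
    have hj1 : 1 ≤ j := hm.trans hmj
    have hj2 : 2 * j ≤ n := by omega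
    have hmj' : (m : ℝ) ≤ j := by exact_mod_cast hmj
    have hj0 : (0 : ℝ) < j := by exact_mod_cast hj1
    have hs1 := div_le_sin_quasimomentum hj1 hj2
    have hs2 := sin_quasimomentum_le hj1 hn
    have hs : 0 < Real.sin (quasimomentum n j) := lt_of_lt_of_le (by positivity) hs1
    have hsq : ((j : ℝ) / n) ^ 2 ≤ Real.sin (quasimomentum n j) ^ 2 :=
      pow_le_pow_left₀ (by positivity) hs1 2
    have hhs : 1000 * h ≤ Real.sin (quasimomentum n j) ^ 2 := by
      refine le_trans ?_ hsq
      rw [div_pow, le_div_iff₀ (by positivity)]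
      exact hmh.trans (pow_le_pow_left₀ (Nat.cast_nonneg m) hmj' 2)
    have hlog : Real.log (4 * Real.sin (quasimomentum n j) ^ 2 / h) ≤ Real.log (4 / h) := by
      refine Real.log_le_log (by positivity) (div_le_div_of_nonneg_right ?_ hh.le)
      linarith [Real.sin_sq_le_one (quasimomentum n j)]
    obtain ⟨θ, h1, h2, h3⟩ := exists_eigenvalue_near hn hs hh hhs (by linarith)
      (exp_quasimomentum n j)
    refine ⟨θ, h1, h2, le_trans ?_ h3⟩
    calc h * n / 24 * (1 / (j : ℕ)) = h / (6 * (4 * j / n)) := by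
          field_simp
          norm_num
      _ ≤ h / (6 * Real.sin (quasimomentum n j)) :=
          div_le_div_of_nonneg_left hh.le (by positivity) (by linarith)
  choose θ hθ hspec hterm using key
  let g : Finset.Ico m (n / 2 + 1) → discreteSpectrum (stepJacobi n h) :=
    fun j => ⟨_, hspec j⟩
  have hg : Function.Injective g := by
    intro i j hij
    have h1 : 2 * Complex.cos (θ i) + Complex.I * h = 2 * Complex.cos (θ j) + Complex.I * h :=
      congrArg Subtype.val hij
    have h2 : Complex.cos (θ i) = Complex.cos (θ j) := by linear_combination h1 / 2
    obtain ⟨hi1, hi2⟩ := Finset.mem_Ico.1 i.2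
    obtain ⟨hj1, hj2⟩ := Finset.mem_Ico.1 j.2
    exact Subtype.ext (eq_of_cos_eq_cos_near_quasimomentum (hm.trans hi1) (by omega)
      (hm.trans hj1) (by omega) (hθ i) (hθ j) h2)
  rw [eigenvalueSum]
  refine le_trans ?_ (ENNReal.tsum_comp_le_tsum_of_injective hg _)
  rw [tsum_fintype, ENNReal.ofReal_sum_of_nonneg (fun j _ => by positivity),
    ← Finset.sum_coe_sort]
  exact Finset.sum_le_sum fun j _ => ENNReal.ofReal_le_ofReal (hterm j)

theorem log_sub_log_le_sum_one_div {a b : ℕ} (ha : 1 ≤ a) (hb : 1 ≤ b) :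
    Real.log b - Real.log a ≤ ∑ j ∈ Finset.Ico a b, (1 : ℝ) / j := by
  rcases le_total b a with hab | hab
  · rw [Finset.Ico_eq_empty_of_le hab, Finset.sum_empty, sub_nonpos]
    exact Real.log_le_log (by exact_mod_cast hb) (by exact_mod_cast hab)
  · induction b, hab using Nat.le_induction with
    | base => simp
    | succ k hk ih =>
      have hk0 : (0 : ℝ) < k := by exact_mod_cast ha.trans hk
      have h1 := Real.log_le_sub_one_of_pos (x := ((k + 1 : ℕ) : ℝ) / k) (by positivity)
      rw [Real.log_div (by positivity) hk0.ne'] at h1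
      have h2 : ((k + 1 : ℕ) : ℝ) / k - 1 = 1 / k := by
        push_cast
        field_simp
        ring
      rw [Finset.sum_Ico_succ_top hk]
      linarith [ih (ha.trans hk)]

theorem eventually_log_four_div_le {α : ℝ} (hα0 : 0 < α) (hα1 : α < 1) :
    ∀ᶠ n : ℕ in atTop, 8 * (Real.log (4 / (n : ℝ) ^ (-α)) + 1) ≤
      (n : ℝ) ^ (-α) * (2 * n + 1) := by
  have h1 : Tendsto (fun x : ℝ => x ^ (1 - α)) atTop atTop :=
    tendsto_rpow_atTop (by linarith)
  have h2 := (isLittleO_log_rpow_atTop (r := 1 - α) (by linarith)).bound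
    (show (0 : ℝ) < 1 / 8 by norm_num)
  filter_upwards [tendsto_natCast_atTop_atTop.eventually h2,
    (h1.comp tendsto_natCast_atTop_atTop).eventually_ge_atTop (8 * (Real.log 4 + 1)),
    eventually_ge_atTop 1] with n hn1 hn2 hn3
  have hn : (1 : ℝ) ≤ n := by exact_mod_cast hn3
  have hn0 : (0 : ℝ) < n := by linarith
  have hlog : 0 ≤ Real.log n := Real.log_nonneg hn
  have hp : 0 < (n : ℝ) ^ (1 - α) := Real.rpow_pos_of_pos hn0 _
  rw [Real.norm_eq_abs, Real.norm_eq_abs, abs_of_nonneg hlog, abs_of_pos hp] at hn1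
  simp only [Function.comp_apply] at hn2
  have h3 : (n : ℝ) ^ (-α) * n = (n : ℝ) ^ (1 - α) := by
    rw [← Real.rpow_add_one hn0.ne']
    ring_nf
  have h4 : 0 < (n : ℝ) ^ (-α) := Real.rpow_pos_of_pos hn0 _
  rw [Real.log_div (by norm_num) h4.ne', Real.log_rpow hn0]
  nlinarith

theorem ofReal_log_le_eigenvalueSum_div {α : ℝ} (hα0 : 0 < α) (hα1 : α < 1) :
    ∀ᶠ n : ℕ in atTop, ENNReal.ofReal (α / 96 * Real.log n) ≤
      eigenvalueSum 0 (stepJacobi n ((n : ℝ) ^ (-α))) /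
        traceNorm (stepJacobi n ((n : ℝ) ^ (-α)) - freeJacobi) := by
  have hlogtop : Tendsto (fun n : ℕ => α / 4 * Real.log n) atTop atTop :=
    (Real.tendsto_log_atTop.comp tendsto_natCast_atTop_atTop).const_mul_atTop (by positivity)
  filter_upwards [eventually_log_four_div_le hα0 hα1,
    hlogtop.eventually_ge_atTop (Real.log 66), eventually_ge_atTop 1] with n hn1 hn2 hn3
  have hn : (1 : ℝ) ≤ n := by exact_mod_cast hn3
  have hn0 : (0 : ℝ) < n := by linarith
  set h := (n : ℝ) ^ (-α) with hh
  have hh0 : 0 < h := Real.rpow_pos_of_pos hn0 _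
  set p := (n : ℝ) ^ (1 - α / 2) with hp
  have hp1 : 1 ≤ p := Real.one_le_rpow hn (by linarith)
  set m := ⌈32 * p⌉₊ with hm
  have hm1 : 32 * p ≤ m := Nat.le_ceil _
  have hm2 : (m : ℝ) ≤ 33 * p := by
    have := (Nat.ceil_lt_add_one (show 0 ≤ 32 * p by positivity)).le
    linarith
  have hm0 : 1 ≤ m := by
    have : (1 : ℝ) ≤ m := by linarith
    exact_mod_cast this
  have hp2 : p ^ 2 = h * n ^ 2 := by
    rw [hp, hh, ← Real.rpow_natCast, ← Real.rpow_natCast, ← Real.rpow_mul hn0.le,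
      ← Real.rpow_add hn0]
    congr 1
    push_cast
    ring
  have hmh : 1000 * h * n ^ 2 ≤ (m : ℝ) ^ 2 := by
    have := pow_le_pow_left₀ (by positivity) hm1 2
    nlinarith [sq_nonneg p]
  have h1 := sum_le_eigenvalueSum_stepJacobi hn3 hm0 hh0 hmh hn1
  have hhalf : (n : ℝ) / 2 ≤ ((n / 2 + 1 : ℕ) : ℝ) := by
    have : n ≤ 2 * (n / 2 + 1) := by omega
    have h3 : (n : ℝ) ≤ 2 * ((n / 2 + 1 : ℕ) : ℝ) := by exact_mod_cast this
    linarith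
  have hsum : α / 4 * Real.log n ≤ ∑ j ∈ Finset.Ico m (n / 2 + 1), (1 : ℝ) / j := by
    refine le_trans ?_ (log_sub_log_le_sum_one_div hm0 (Nat.succ_pos _))
    have h3 : Real.log m ≤ Real.log (33 * p) :=
      Real.log_le_log (by exact_mod_cast hm0) hm2
    have h4 : Real.log (n / 2) ≤ Real.log ((n / 2 + 1 : ℕ) : ℝ) :=
      Real.log_le_log (by positivity) hhalf
    have h5 : Real.log 66 = Real.log 33 + Real.log 2 := by
      rw [← Real.log_mul (by norm_num) (by norm_num)]
      norm_num
    rw [Real.log_mul (by norm_num) (by positivity), hp, Real.log_rpow hn0] at h3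
    rw [Real.log_div hn0.ne' two_ne_zero] at h4
    linarith
  rw [traceNorm_stepJacobi_sub_freeJacobi n hh0.le]
  have hnh : 0 < (n : ℝ) * h := by positivity
  rw [ENNReal.le_div_iff_mul_le (Or.inl (ENNReal.ofReal_pos.2 hnh).ne')
    (Or.inl ENNReal.ofReal_ne_top), ← ENNReal.ofReal_mul (by
      have := Real.log_nonneg hn
      positivity)]
  refine le_trans (ENNReal.ofReal_le_ofReal ?_) h1
  rw [← Finset.mul_sum]
  have h6 := mul_le_mul_of_nonneg_left hsum (show 0 ≤ h * n / 24 by positivity)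
  linarith

theorem tendsto_eigenvalueSum_div_traceNorm {α : ℝ} (hα0 : 0 < α) (hα1 : α < 1) :
    Tendsto (fun n : ℕ => eigenvalueSum 0 (stepJacobi n ((n : ℝ) ^ (-α))) /
      traceNorm (stepJacobi n ((n : ℝ) ^ (-α)) - freeJacobi)) atTop (𝓝 ∞) := by
  have h1 : Tendsto (fun n : ℕ => α / 96 * Real.log n) atTop atTop :=
    (Real.tendsto_log_atTop.comp tendsto_natCast_atTop_atTop).const_mul_atTop (by positivity)
  exact tendsto_nhds_top_mono (ENNReal.tendsto_ofReal_atTop.comp h1)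
    (ofReal_log_le_eigenvalueSum_div hα0 hα1)

theorem not_liebThirring_zero : ¬ LiebThirring 0 := by
  rintro ⟨C, -, hC⟩
  -- Any exponent in `(0,1)` would do. With `a = c = 1` the right-hand sum of the inequality equals
  -- the trace norm `nh`.
  have htend := tendsto_eigenvalueSum_div_traceNorm (α := 1 / 2) (by norm_num) (by norm_num)
  obtain ⟨n, hn, hn1⟩ := ((htend.eventually
    (lt_mem_nhds (show ENNReal.ofReal C < ∞ from ENNReal.ofReal_lt_top))).and
    (eventually_ge_atTop 1)).exists
  have hn0 : (0 : ℝ) < n := by exact_mod_cast hn1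
  set h := (n : ℝ) ^ (-(1 / 2) : ℝ)
  have hh : 0 < h := Real.rpow_pos_of_pos hn0 _
  have htr := traceNorm_stepJacobi_sub_freeJacobi n hh.le
  have h1 := hC 1 (stepPotential n h) 1 (fun j => by simp) (by
    change traceNorm (stepJacobi n h - freeJacobi) < ∞
    rw [htr]
    exact ENNReal.ofReal_lt_top)
  have hsum : ∑' j : ℕ, ENNReal.ofReal (‖stepPotential n h j‖ +
      ‖1 - (1 : ℓ^∞(ℕ, ℂ)) j * (1 : ℓ^∞(ℕ, ℂ)) j‖) = ENNReal.ofReal (n * h) := by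
    rw [tsum_eq_sum (s := Finset.range n)]
    · have h2 : ∀ j ∈ Finset.range n, ENNReal.ofReal (‖stepPotential n h j‖ +
          ‖1 - (1 : ℓ^∞(ℕ, ℂ)) j * (1 : ℓ^∞(ℕ, ℂ)) j‖) = ENNReal.ofReal h := fun j hj => by
        rw [stepPotential_apply, if_pos (Finset.mem_range.1 hj)]
        simp [abs_of_pos hh]
      rw [Finset.sum_congr rfl h2, Finset.sum_const, Finset.card_range, nsmul_eq_mul,
        ENNReal.ofReal_mul (Nat.cast_nonneg n), ENNReal.ofReal_natCast]
    · intro j hj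
      rw [stepPotential_apply, if_neg fun h => hj (Finset.mem_range.2 h)]
      simp
  rw [hsum] at h1
  refine absurd hn (not_lt.2 ?_)
  rw [htr]
  exact ENNReal.div_le_of_le_mul h1

end JacobiLT

end

theorem mainTheorem3 :
    (∀ α : ℝ, 0 < α → α < 1 →
      (∃ C : ℝ, 0 < C ∧ ∀ᶠ n : ℕ in atTop,
        ENNReal.ofReal (C * Real.log n) ≤
          JacobiLT.eigenvalueSum 0 (JacobiLT.stepJacobi n ((n : ℝ) ^ (-α))) /
            JacobiLT.traceNorm
              (JacobiLT.stepJacobi n ((n : ℝ) ^ (-α)) - JacobiLT.freeJacobi)) ∧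
      Tendsto (fun n : ℕ =>
          JacobiLT.eigenvalueSum 0 (JacobiLT.stepJacobi n ((n : ℝ) ^ (-α))) /
            JacobiLT.traceNorm
              (JacobiLT.stepJacobi n ((n : ℝ) ^ (-α)) - JacobiLT.freeJacobi))
        atTop (𝓝 ∞)) ∧
    ¬ JacobiLT.LiebThirring 0 := by
  refine ⟨fun α hα0 hα1 => ⟨⟨α / 96, by positivity, ?_⟩, ?_⟩, JacobiLT.not_liebThirring_zero⟩
  · exact JacobiLT.ofReal_log_le_eigenvalueSum_div hα0 hα1
  · exact JacobiLT.tendsto_eigenvalueSum_div_traceNorm hα0 hα1
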